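/- **Setting.** Let $K$ be a field. Let $\alpha$ be a type of abstract power-products: a cancellative commutative monoid with least common multiples in which $1$ is the only invertible element, and which admits a Dickson grading, i.e. a map $d:\alpha\to\mathbb N$ with $d(st)=\max(d(s),d(t))$ such that every sequence $(s_i)_{i\in\mathbb N}$ in $\alpha$ on which $d$ is bounded has indices $i<j$ with $s_i\mid s_j$. (Example: the power-products in finitely or countably many indeterminates.) Let $\kappa$ be a non-empty well-ordered set of component-indices. *Terms* are the pairs $t\,e_i$ with $t\in\alpha$, $i\in\kappa$; $s\,e_i$ divides $t\,e_j$ iff $i=j$ and $s\mid t$. Vector-polynomials are finite $K$-linear combinations of terms. Fix a linear order $\preceq$ on $\alpha$ with $1\preceq s$, and $s\preceq t\Rightarrow su\preceq tu$, and a linear order $\preceq_t$ on terms such that $s\,e_i\preceq_t t\,e_j$ implies $us\,e_i\preceq_t ut\,e_j$, and $s\preceq t$, $i\le j$ imply $s\,e_i\preceq_t t\,e_j$. For $p\ne0$ let $\mathrm{lt}(p)$, $\mathrm{lp}(p)$, $\mathrm{lc}(p)$ be the leading term, its power-product, and its coefficient. For a set $F$ of vector-polynomials, $p\to_F q$ means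 that there are $0\neq f\in F$ and $t\in\alpha$ such that the coefficient $c$ of $t\cdot\mathrm{lt}(f)$ in $p$ is non-zero and $q=p-\frac{c}{\mathrm{lc}(f)}\,t f$; $\to_F^*$ is the reflexive-transitive closure. $F$ is a *Gröbner basis* iff $\to_F$ is confluent. $\mathrm{pmdl}(F)$ is the submodule generated by $F$. The S-polynomial $\mathrm{spoly}(p,q)$ is $\frac{l}{\mathrm{lc}(p)\mathrm{lp}(p)}p-\frac{l}{\mathrm{lc}(q)\mathrm{lp}(q)}q$ with $l=\mathrm{lcm}(\mathrm{lp}(p),\mathrm{lp}(q))$ if $\mathrm{lt}(p)$ and $\mathrm{lt}(q)$ have the same component, and $0$ otherwise. **One step of F4.** Let $bs$ be a finite list of vector-polynomials (the current basis) and $sps$ a finite list of pairs of vector-polynomials. * *Symbolic preprocessing*: let $fs$ initially consist of the two polynomials $\frac{l}{\mathrm{lc}(p)\mathrm{lp}(p)}p$ and $\frac{l}{\mathrm{lc}(q)\mathrm{lp}(q)}q$ for each $(p,q)\in sps$, and let $vs$ be the list of terms appearing in them. While $vs$ is non-empty, remove its largest term $v$ from $vs$, and for each non-zero $b\in bs$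 with $\mathrm{lt}(b)\mid v$ add to $fs$ the multiple $t b$ ($t\in\alpha$) with $\mathrm{lt}(tb)=v$, and to $vs$ all terms of $tb$ other than $v$. Return $fs$. * Form the *Macaulay matrix* of $fs$: its rows are the coefficients of the elements of $fs$ at the distinct terms appearing in $fs$, in descending order. Let $\mathrm{f4red}(bs,sps)$ be the list of all non-zero polynomials given by the rows of the reduced row echelon form of that matrix whose leading term is not the leading term of a non-zero element of $fs$. **The algorithm F4.** Let $\mathrm{sel}$ be a function that for all $bs$ and non-empty $ps$ returns a non-empty list $\mathrm{sel}(bs,ps)$ of elements of $ps$, and let $\mathrm{keep}$ be a function such that $\mathrm{keep}(bs,ps,sps)$ is a list of elements of $sps$, and every $(p,q)\in sps$ not in this list satisfies one of: (a) $\mathrm{spoly}(p,q)\to_{bs}^*0$; (b) $\kappa$ has only one element and $\mathrm{lp}(p)$, $\mathrm{lp}(q)$ are relatively prime (product criterion); (c) there is $0\ne r\in bs$ such that $\mathrm{lt}(r)$ divides the term with power-product $\mathrm{lcm}(\mathrm{lp}(p),\mathrm{lp}(q))$ and the component of $\mathrm{lt}(p)$, and $\mathrm{spoly}(p,r)\to_{bs}^*0$,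 $\mathrm{spoly}(r,q)\to_{bs}^*0$ (chain criterion). (Discarding nothing is allowed.) On input of a finite list $bs$, let $ps$ contain exactly one of $(h_1,h_2)$, $(h_2,h_1)$ for any two distinct elements of $bs$. Repeat the following until $ps$ is empty or for every component $i$ appearing in $bs$ there is a non-zero $b\in bs$ with $\mathrm{lt}(b)=1\,e_i$: let $sps=\mathrm{sel}(bs,ps)$, let $ps_0$ be $ps$ without the elements of $sps$, and $hs=\mathrm{f4red}(bs,\mathrm{keep}(bs,ps_0,sps))$; replace $ps$ by the list of all pairs in $ps_0$, all $(h,b)$ with $h\in hs$, $b\in bs$, and one of $(h_1,h_2)$, $(h_2,h_1)$ for any two distinct elements of $hs$; and append $hs$ to $bs$. Finally return $bs$. **Theorem.** 1. Symbolic preprocessing terminates for all $bs$ and $sps$, so $\mathrm{f4red}(bs,sps)$ is well-defined. 2. For all $bs$, $sps$, every $h\in\mathrm{f4red}(bs,sps)$ is non-zero, and $\mathrm{lt}(b)\nmid\mathrm{lt}(h)$ for every non-zero $b\in bs$. 3. If $sps$ consists of pairs of elements of $bs$ and $hs=\mathrm{f4red}(bs,sps)$, then $hs\subseteq\mathrm{pmdl}(bs)$,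 and $\mathrm{spoly}(p,q)\to_{bs\cup hs}^*0$ for all $(p,q)\in sps$. 4. For all $\mathrm{sel}$ and $\mathrm{keep}$ as above and every finite input list $bs$, F4 terminates, and its output $gs$ is a Gröbner basis with $\mathrm{pmdl}(gs)=\mathrm{pmdl}(bs)$. -/

import Mathlib

/-! # The F4 algorithm for submodules of free modules over polynomial rings -/

namespace F4

/-! ## Power-products, terms, term orders -/

/-- Types of abstract power-products: cancellative commutative monoids with least common
multiples, in which `1` is the only invertible element, and which admit a Dickson grading. -/
class GradedDicksonPowerprod (α : Type*) [CancelCommMonoid α] where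
  /-- The least common multiple. -/
  lcm : α → α → α
  dvd_lcm : ∀ s t : α, s ∣ lcm s t
  lcm_dvd : ∀ s t u : α, s ∣ u → t ∣ u → lcm s t ∣ u
  lcm_comm : ∀ s t : α, lcm s t = lcm t s
  mul_eq_one : ∀ s t : α, s * t = 1 → s = 1
  exists_dicksonGrading : ∃ d : α → ℕ, (∀ s t : α, d (s * t) = max (d s) (d t)) ∧
    ∀ (m : ℕ) (s : ℕ → α), (∀ i, d (s i) ≤ m) → ∃ i j : ℕ, i < j ∧ s i ∣ s j

/-- The term `t e_i` with power-product `t` and component-index `i`. -/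
@[ext]
structure Term (α κ : Type*) where
  /-- The power-product. -/
  pp : α
  /-- The component-index. -/
  comp : κ

/-- Multiplication of a term by a power-product. -/
def stimes {α κ : Type*} [Mul α] (t : α) (v : Term α κ) : Term α κ := ⟨t * v.pp, v.comp⟩

/-- Divisibility of terms. -/
def Term.Dvd {α κ : Type*} [CancelCommMonoid α] (u v : Term α κ) : Prop :=
  u.comp = v.comp ∧ u.pp ∣ v.pp

/-- The linear order on `α` is admissible, and the linear order on terms extends it
compatibly. -/
class IsTermOrder (α κ : Type*) [CancelCommMonoid α] [LinearOrder α] [LinearOrder κ]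
    [LinearOrder (Term α κ)] : Prop where
  one_le : ∀ s : α, 1 ≤ s
  mul_le_mul : ∀ s t u : α, s ≤ t → s * u ≤ t * u
  stimes_le_stimes : ∀ (u : α) (v w : Term α κ), v ≤ w → stimes u v ≤ stimes u w
  term_le_term : ∀ v w : Term α κ, v.pp ≤ w.pp → v.comp ≤ w.comp → v ≤ w

open Classical in
/-- The quotient `t / s` of power-products; only used if `s` divides `t`. -/
noncomputable def ppDiv {α : Type*} [CancelCommMonoid α] (t s : α) : α :=
  if h : s ∣ t then h.choose else 1

/-! ## Vector-polynomials -/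

/-- Vector-polynomials: finite `K`-linear combinations of terms. The coefficient of the term `v`
in `p` is `p v`, and the set of terms appearing in `p` is `p.support`. -/
abbrev VPoly (α κ K : Type*) [Field K] := Term α κ →₀ K

section Poly

variable {α κ K : Type*} [CancelCommMonoid α] [Field K]

/-- Multiplication of a vector-polynomial by the monomial `c t`. -/
noncomputable def monomMult (c : K) (t : α) (p : VPoly α κ K) : VPoly α κ K :=
  c • Finsupp.mapDomain (stimes t) p

/-- The submodule generated by `B`: the smallest set that contains `B ∪ {0}` and is closed under
addition and under multiplication by monomials. -/
inductive pmdl (B : Set (VPoly α κ K)) : Set (VPoly α κ K)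
  | zero : pmdl B 0
  | base (b : VPoly α κ K) : b ∈ B → pmdl B b
  | add (p q : VPoly α κ K) : pmdl B p → pmdl B q → pmdl B (p + q)
  | monomMult (c : K) (t : α) (p : VPoly α κ K) : pmdl B p → pmdl B (monomMult c t p)

variable [Nonempty κ] [LinearOrder (Term α κ)]

/-- The leading term of a non-zero polynomial (an arbitrary term for `0`). -/
noncomputable def lt (p : VPoly α κ K) : Term α κ :=
  if h : p.support.Nonempty then p.support.max' h else ⟨1, Classical.arbitrary κ⟩

/-- The leading power-product. -/
noncomputable def lp (p : VPoly α κ K) : α := (lt p).pp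

/-- The leading coefficient. -/
noncomputable def lc (p : VPoly α κ K) : K := p (lt p)

/-- The tail: the polynomial without its leading monomial. -/
noncomputable def tail (p : VPoly α κ K) : VPoly α κ K := p.erase (lt p)

/-! ## Reduction, Gröbner bases, S-polynomials -/

/-- `p` reduces to `q` modulo `f` using `t`. -/
def RedSingle (p q f : VPoly α κ K) (t : α) : Prop :=
  f ≠ 0 ∧ p (stimes t (lt f)) ≠ 0 ∧ q = p - monomMult (p (stimes t (lt f)) / lc f) t f

/-- `p` reduces to `q` modulo the set `F` in one step. -/
def Red (F : Set (VPoly α κ K)) (p q : VPoly α κ K) : Prop :=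
  ∃ f ∈ F, ∃ t : α, RedSingle p q f t

/-- `p` reduces to `q` modulo the set `F` in finitely many steps. -/
def RedStar (F : Set (VPoly α κ K)) : VPoly α κ K → VPoly α κ K → Prop :=
  Relation.ReflTransGen (Red F)

/-- `F` is a Gröbner basis: the reduction relation modulo `F` is confluent. -/
def IsGroebnerBasis (F : Set (VPoly α κ K)) : Prop :=
  ∀ p q₁ q₂ : VPoly α κ K, RedStar F p q₁ → RedStar F p q₂ →
    ∃ r : VPoly α κ K, RedStar F q₁ r ∧ RedStar F q₂ r

variable [GradedDicksonPowerprod α]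

open Classical in
/-- The S-polynomial of `p` and `q`. -/
noncomputable def spoly (p q : VPoly α κ K) : VPoly α κ K :=
  if (lt p).comp = (lt q).comp then
    let l := GradedDicksonPowerprod.lcm (lp p) (lp q)
    monomMult (1 / lc p) (ppDiv l (lp p)) p - monomMult (1 / lc q) (ppDiv l (lp q)) q
  else 0

end Poly

/-! ## Loops -/

open Classical in
/-- The result of `while c do f`, started in state `s`; `none` if the loop does not terminate. -/
noncomputable def whileOption {σ : Type*} (c : σ → Prop) (f : σ → σ) (s : σ) : Option σ :=
  if h : ∃ n : ℕ, ¬ c (f^[n] s) then some (f^[Nat.find h] s) else none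

/-! ## Reduced row echelon form -/

/-- Every matrix over a field is row equivalent to one in reduced row echelon form. -/
theorem exists_reducedRowEchelon {K : Type*} [Field K] {m n : ℕ} (A : Matrix (Fin m) (Fin n) K) :
    ∃ B : Matrix (Fin m) (Fin n) K,
      B.IsReducedRowEchelon ∧ ∃ P : Matrix (Fin m) (Fin m) K, IsUnit P ∧ B = P * A := by
  classical
  have key : ∀ k : ℕ, k ≤ n → ∃ (P : Matrix (Fin m) (Fin m) K) (r : ℕ) (c : ℕ → ℕ),
      IsUnit P ∧ (∀ (i : Fin m) (j : Fin n), r ≤ i → (j : ℕ) < k → (P * A) i j = 0) ∧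
      (∀ i : Fin m, (i : ℕ) < r → c i < k ∧
        (∀ j : Fin n, (j : ℕ) < c i → (P * A) i j = 0) ∧
        ∀ (i' : Fin m) (j : Fin n), (j : ℕ) = c i → (P * A) i' j = if i' = i then 1 else 0) ∧
      ∀ i i' : ℕ, i < i' → i' < r → c i < c i' := by
    intro k
    induction k with
    | zero => exact fun _ => ⟨1, 0, fun _ => 0, isUnit_one, by simp, by simp, by simp⟩
    | succ k ih =>
      intro hk
      obtain ⟨P, r, c, hP, h0, hc, hmono⟩ := ih (by omega)
      by_cases hz : ∀ i : Fin m, r ≤ i → (P * A) i ⟨k, hk⟩ = 0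
      · refine ⟨P, r, c, hP, fun i j hi hj => ?_, fun i hi => ?_, hmono⟩
        · rcases Nat.lt_succ_iff_lt_or_eq.1 hj with h | h
          · exact h0 i j hi h
          · have : j = ⟨k, hk⟩ := Fin.ext h
            rw [this]; exact hz i hi
        · exact ⟨(hc i hi).1.trans k.lt_succ_self, (hc i hi).2⟩
      · push Not at hz
        obtain ⟨i₀, hi₀, hne⟩ := hz
        obtain ⟨q, hq⟩ : ∃ q : Fin m, (q : ℕ) = r := ⟨⟨r, by omega⟩, rfl⟩
        set C : Matrix (Fin m) (Fin n) K := (P * A).submatrix (Equiv.swap q i₀) id with hC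
        have hCne : C q ⟨k, hk⟩ ≠ 0 := by simpa [hC] using hne
        set d := C q ⟨k, hk⟩ with hd
        let w : Fin m → K := fun i => if i = q then d⁻¹ else -(C i ⟨k, hk⟩ * d⁻¹)
        let T : Matrix (Fin m) (Fin m) K := (1 : Matrix (Fin m) (Fin m) K).updateCol q w
        let S : Matrix (Fin m) (Fin m) K := (Equiv.swap q i₀).toPEquiv.toMatrix
        have hT : IsUnit T := by
          rw [Matrix.isUnit_iff_isUnit_det, ← Matrix.cramer_apply, Matrix.cramer_one]
          simpa [w] using hCne
        have hS : IsUnit S := by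
          refine IsUnit.of_mul_eq_one (b := S) ?_
          rw [PEquiv.toMatrix_toPEquiv_mul]
          ext i j
          simp [S, PEquiv.toMatrix_apply, Matrix.one_apply]
        have hSA : S * (P * A) = C := PEquiv.toMatrix_toPEquiv_mul _ _
        have hB : T * S * P * A = T * C := by rw [← hSA]; simp only [Matrix.mul_assoc]
        have hTC : ∀ i j, (T * C) i j =
            if i = q then d⁻¹ * C q j else C i j - C i ⟨k, hk⟩ * d⁻¹ * C q j := by
          intro i j
          have hTe : ∀ x, T i x = (if i = x then 1 else 0) +
              (if x = q then w i - (if i = q then 1 else 0) else 0) := by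
            intro x
            by_cases hx : x = q
            · subst hx; simp [T]
            · simp [T, hx, Matrix.one_apply]
          rw [Matrix.mul_apply]
          simp only [hTe, add_mul, Finset.sum_add_distrib, ite_mul, one_mul, zero_mul,
            Finset.sum_ite_eq, Finset.sum_ite_eq', Finset.mem_univ, if_true]
          by_cases hi : i = q
          · simp [hi, w]; ring
          · simp [hi, w]; ring
        have hCz : ∀ (i : Fin m) (j : Fin n), r ≤ i → (j : ℕ) < k → C i j = 0 := by
          intro i j hi hj
          refine h0 _ _ ?_ hj
          rw [Equiv.swap_apply_def]
          split_ifs <;> omega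
        have hCs : ∀ (i : Fin m) (j : Fin n), (i : ℕ) < r → C i j = (P * A) i j := by
          intro i j hi
          have h1 : i ≠ q := by rintro rfl; omega
          have h2 : i ≠ i₀ := by rintro rfl; omega
          simp [hC, Equiv.swap_apply_of_ne_of_ne h1 h2]
        have hqz : ∀ j : Fin n, (j : ℕ) < k → C q j = 0 := fun j hj => hCz q j hq.ge hj
        refine ⟨T * S * P, r + 1, fun i => if i = r then k else c i, (hT.mul hS).mul hP,
          fun i j hi hj => ?_, fun i hi => ?_, fun i i' hii hi' => ?_⟩
        · have hiq : i ≠ q := by rintro rfl; omega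
          rw [hB, hTC, if_neg hiq]
          rcases Nat.lt_succ_iff_lt_or_eq.1 hj with h | h
          · rw [hqz j h, hCz i j (by omega) h]; simp
          · have : j = ⟨k, hk⟩ := Fin.ext h
            rw [this, ← hd, mul_assoc, inv_mul_cancel₀ hCne]; simp
        · rw [hB]
          by_cases hir : (i : ℕ) = r
          · have hiq : i = q := Fin.ext (hir.trans hq.symm)
            subst hiq
            simp only [hir, if_true]
            refine ⟨k.lt_succ_self, fun j hj => ?_, fun i' j hj => ?_⟩
            · rw [hTC, if_pos rfl, hqz j hj, mul_zero]
            · have : j = ⟨k, hk⟩ := Fin.ext hj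
              rw [this, hTC, ← hd, mul_assoc, inv_mul_cancel₀ hCne]
              simp
          · have hlt : (i : ℕ) < r := by omega
            have hiq : i ≠ q := by rintro rfl; omega
            have hi0 : i ≠ i₀ := by rintro rfl; omega
            obtain ⟨h1, h2, h3⟩ := hc i hlt
            simp only [hir, if_false]
            refine ⟨h1.trans k.lt_succ_self, fun j hj => ?_, fun i' j hj => ?_⟩
            · rw [hTC, if_neg hiq, hqz j (hj.trans h1), hCs i j hlt, h2 j hj]; simp
            · rw [hTC, hqz j (hj ▸ h1)]
              by_cases hi'q : i' = q
              · simp [hi'q, hiq.symm]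
              · have : C i' j = if Equiv.swap q i₀ i' = i then 1 else 0 := h3 _ j hj
                rw [if_neg hi'q, mul_zero, sub_zero, this]
                simp only [Equiv.swap_apply_eq_iff, Equiv.swap_apply_of_ne_of_ne hiq hi0]
        · have hir : i ≠ r := by omega
          simp only [hir, if_false]
          split_ifs with h
          · exact (hc ⟨i, by omega⟩ (by simp; omega)).1
          · exact hmono i i' hii (by omega)
  obtain ⟨P, r, c, hP, h0, hc, hmono⟩ := key n le_rfl
  have hlead : ∀ (i : Fin m) (j : Fin n), (P * A).IsLeadingEntry i j →
      (i : ℕ) < r ∧ (j : ℕ) = c i := by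
    intro i j hl
    have hr : (i : ℕ) < r := by
      by_contra hr
      exact hl.2 (h0 i j (not_lt.1 hr) j.2)
    have h1 : (P * A) i ⟨c i, (hc i hr).1⟩ = 1 := by
      rw [(hc i hr).2.2 i ⟨c i, (hc i hr).1⟩ rfl, if_pos rfl]
    have hl' : (P * A).IsLeadingEntry i ⟨c i, (hc i hr).1⟩ :=
      ⟨fun j' hj' => (hc i hr).2.1 j' hj', by rw [h1]; exact one_ne_zero⟩
    exact ⟨hr, congrArg Fin.val (hl.unique hl')⟩
  refine ⟨P * A, ⟨?_, ?_, ?_⟩, P, hP, rfl⟩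
  · intro i₁ i₂ hlt j₂ hz
    by_cases h2 : (i₂ : ℕ) < r
    · have h1 : (i₁ : ℕ) < r := lt_trans hlt h2
      apply (hc i₂ h2).2.1
      have := hmono _ _ hlt h2
      by_contra hcon
      have hlt' : c i₁ < j₂ := by omega
      have := (hc i₁ h1).2.2 i₁ ⟨c i₁, (hc i₁ h1).1⟩ rfl
      rw [hz _ hlt'] at this
      simp at this
    · exact h0 _ _ (not_lt.1 h2) j₂.2
  · intro i j hl
    obtain ⟨hr, hj⟩ := hlead i j hl
    rw [(hc i hr).2.2 i j hj, if_pos rfl]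
  · intro i₁ i₂ j hlt hl
    obtain ⟨hr, hj⟩ := hlead i₂ j hl
    rw [(hc i₂ hr).2.2 i₁ j hj, if_neg hlt.ne]

/-- The reduced row echelon form of a matrix. -/
noncomputable def rowEchelon {K : Type*} [Field K] {m n : ℕ} (A : Matrix (Fin m) (Fin n) K) :
    Matrix (Fin m) (Fin n) K :=
  (exists_reducedRowEchelon A).choose

/-! ## Macaulay matrices -/

section Algorithm

variable {α κ K : Type*} [CancelCommMonoid α] [Field K] [LinearOrder (Term α κ)]

/-- The list of all distinct terms appearing in `fs`, in descending order. -/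
noncomputable def keysToList (fs : List (VPoly α κ K)) : List (Term α κ) :=
  (fs.foldr (fun (f : VPoly α κ K) (S : Finset (Term α κ)) => f.support ∪ S) ∅).sort
    (fun u v => v ≤ u)

/-- The matrix whose rows are the coefficients of the `fs` at the terms `vs`. -/
def polysToMat (vs : List (Term α κ)) (fs : List (VPoly α κ K)) :
    Matrix (Fin fs.length) (Fin vs.length) K :=
  Matrix.of fun i j => fs.get i (vs.get j)

/-- The list of polynomials whose coefficients at the (distinct) terms `vs` are the rows of `A`. -/
noncomputable def matToPolys {m : ℕ} (vs : List (Term α κ)) (A : Matrix (Fin m) (Fin vs.length) K) :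
    List (VPoly α κ K) :=
  List.ofFn fun i => ∑ j, Finsupp.single (vs.get j) (A i j)

/-- The Macaulay matrix of `fs`. -/
noncomputable def macaulayMat (fs : List (VPoly α κ K)) :
    Matrix (Fin fs.length) (Fin (keysToList fs).length) K :=
  polysToMat (keysToList fs) fs

variable [Nonempty κ]

open Classical in
/-- The non-zero polynomials in the reduced row echelon form of the Macaulay matrix of `fs` whose
leading terms are not among those of `fs`. -/
noncomputable def macaulayRed (fs : List (VPoly α κ K)) : List (VPoly α κ K) :=
  let lts := (fs.filter (fun f => f ≠ 0)).map lt
  (matToPolys (keysToList fs) (rowEchelon (macaulayMat fs))).filter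
    (fun f => f ≠ 0 ∧ lt f ∉ lts)

/-! ## Symbolic preprocessing -/

open Classical in
/-- For every non-zero `b` in `bs` whose leading term divides `v`, add to `fs` the multiple of `b`
with leading power-product that of `v`, and add the terms of its tail to the terms `vs` that
still have to be considered. -/
noncomputable def symPreprocAddnew : List (VPoly α κ K) → List (Term α κ) → List (VPoly α κ K) →
    Term α κ → List (Term α κ) × List (VPoly α κ K)
  | [], vs, fs, _ => (vs, fs)
  | b :: bs, vs, fs, v =>
    if b ≠ 0 ∧ (lt b).Dvd v then
      let f := monomMult 1 (ppDiv v.pp (lp b)) b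
      symPreprocAddnew bs (vs ++ keysToList [tail f]) (if f ∈ fs then fs else f :: fs) v
    else
      symPreprocAddnew bs vs fs v

/-- One iteration of the main loop of symbolic preprocessing: remove the largest term from the
terms `vs` still to be considered, and add the multiples of `bs` needed for reducing it. -/
noncomputable def symPreprocStep (bs : List (VPoly α κ K))
    (s : List (Term α κ) × List (VPoly α κ K)) : List (Term α κ) × List (VPoly α κ K) :=
  match s.1.max? with
  | none => s
  | some v => symPreprocAddnew bs (s.1.filter (fun u => u ≠ v)) s.2 v

variable [GradedDicksonPowerprod α]

/-- The two multiples of `p` and `q` whose difference is the S-polynomial of `p` and `q` if the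
leading terms of `p` and `q` have the same component, for all given pairs `(p, q)`. -/
noncomputable def pairsToList (sps : List (VPoly α κ K × VPoly α κ K)) : List (VPoly α κ K) :=
  sps.flatMap fun x =>
    let l := GradedDicksonPowerprod.lcm (lp x.1) (lp x.2)
    [monomMult (1 / lc x.1) (ppDiv l (lp x.1)) x.1, monomMult (1 / lc x.2) (ppDiv l (lp x.2)) x.2]

/-- Symbolic preprocessing of the pairs `sps` with respect to the basis `bs`
(`none` if the loop does not terminate). -/
noncomputable def symPreproc (bs : List (VPoly α κ K)) (sps : List (VPoly α κ K × VPoly α κ K)) :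
    Option (List (VPoly α κ K)) :=
  (whileOption (fun s => s.1 ≠ []) (symPreprocStep bs)
    (keysToList (pairsToList sps), pairsToList sps)).map Prod.snd

/-- The polynomials that an iteration of F4 with selected pairs `sps` adds to the basis `bs`
(with a dummy value if symbolic preprocessing does not terminate). -/
noncomputable def f4Red (bs : List (VPoly α κ K)) (sps : List (VPoly α κ K × VPoly α κ K)) :
    List (VPoly α κ K) :=
  ((symPreproc bs sps).map macaulayRed).getD []

/-! ## The algorithm schema and F4 -/

/-- For every component-index `i` appearing in `bs` there is a non-zero `b` in `bs` with leading
term `1 e_i`. -/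
def GenWholeModule (bs : List (VPoly α κ K)) : Prop :=
  ∀ b ∈ bs, ∀ v ∈ b.support, ∃ b' ∈ bs, b' ≠ 0 ∧ (lt b').comp = v.comp ∧ lp b' = 1

/-- One of the pairs `(h₁, h₂)`, `(h₂, h₁)` for any two distinct elements of a list without
repetitions. -/
def distinctPairs {β : Type*} : List β → List (β × β)
  | [] => []
  | h :: hs => hs.map (fun h' => (h, h')) ++ distinctPairs hs

open Classical in
/-- The pairs to be considered after `hs` has been added to the basis `bs`. -/
noncomputable def addPairs {β : Type*} (bs : List β) (ps : List (β × β)) (hs : List β) :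
    List (β × β) :=
  ps ++ hs.flatMap (fun h => bs.map fun b => (h, b)) ++ distinctPairs hs.dedup

open Classical in
/-- The elements of the first list that are not in the second one. -/
noncomputable def diffList {β : Type*} (xs ys : List β) : List β :=
  xs.filter (fun x => x ∉ ys)

/-- The main loop of the algorithm schema, with current basis `bs` and list `ps` of pairs still to
be considered (`none` if it does not terminate). -/
noncomputable def gbSchemaAux
    (sel : List (VPoly α κ K) → List (VPoly α κ K × VPoly α κ K) →
      List (VPoly α κ K × VPoly α κ K))
    (compl : List (VPoly α κ K) → List (VPoly α κ K × VPoly α κ K) →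
      List (VPoly α κ K × VPoly α κ K) → List (VPoly α κ K))
    (bs : List (VPoly α κ K)) (ps : List (VPoly α κ K × VPoly α κ K)) :
    Option (List (VPoly α κ K)) :=
  (whileOption (fun s => ¬ (s.2 = [] ∨ GenWholeModule s.1))
    (fun s =>
      let sps := sel s.1 s.2
      let ps₀ := diffList s.2 sps
      let hs := compl s.1 ps₀ sps
      (s.1 ++ hs, addPairs s.1 ps₀ hs))
    (bs, ps)).map Prod.fst

/-- The algorithm schema for computing Gröbner bases. -/
noncomputable def gbSchema
    (sel : List (VPoly α κ K) → List (VPoly α κ K × VPoly α κ K) →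
      List (VPoly α κ K × VPoly α κ K))
    (compl : List (VPoly α κ K) → List (VPoly α κ K × VPoly α κ K) →
      List (VPoly α κ K × VPoly α κ K) → List (VPoly α κ K))
    (bs : List (VPoly α κ K)) : Option (List (VPoly α κ K)) :=
  gbSchemaAux sel compl bs (addPairs [] [] bs)

/-- A pair may be discarded without considering its S-polynomial if that S-polynomial reduces to
`0` modulo the current basis, by the product criterion (for scalar polynomials), or by the chain
criterion. -/
def IsDiscardable (bs : List (VPoly α κ K)) (p q : VPoly α κ K) : Prop :=
  RedStar {b | b ∈ bs} (spoly p q) 0 ∨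
  (Subsingleton κ ∧ IsRelPrime (lp p) (lp q)) ∨
  ∃ r ∈ bs, r ≠ 0 ∧
    (lt r).Dvd ⟨GradedDicksonPowerprod.lcm (lp p) (lp q), (lt p).comp⟩ ∧
    RedStar {b | b ∈ bs} (spoly p r) 0 ∧ RedStar {b | b ∈ bs} (spoly r q) 0

/-- The F4 algorithm: the instance of the algorithm schema where `keep` removes some of the selected
pairs, and `f4Red` is applied to the remaining ones. -/
noncomputable def f4
    (sel : List (VPoly α κ K) → List (VPoly α κ K × VPoly α κ K) →
      List (VPoly α κ K × VPoly α κ K))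
    (keep : List (VPoly α κ K) → List (VPoly α κ K × VPoly α κ K) →
      List (VPoly α κ K × VPoly α κ K) → List (VPoly α κ K × VPoly α κ K))
    (bs : List (VPoly α κ K)) : Option (List (VPoly α κ K)) :=
  gbSchema sel (fun bs ps sps => f4Red bs (keep bs ps sps)) bs

end Algorithm

end F4

open F4

/-! The term order need not be well-founded, since there may be infinitely many indeterminates, but
it is well-founded on terms of Dickson degree at most `m` (`IsDicksonGrading.wellFoundedOn`). As the
degree of a product is the maximum of the degrees, least common multiples and multiples by cofactors
of degree at most `m` stay in this region. Hence reduction, symbolic preprocessing and a whole run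
of F4 each take place inside one box `termBox d m C`.

One step of F4 is linear algebra. For pairs from `bs`, symbolic preprocessing yields a list `fs` of
multiples of elements of `bs` in which every term divisible by a leading term of `bs` is itself a
leading term in `fs`; so a row whose leading term is new has a leading term that no leading term of
`bs` divides. Every leading term of the span of `fs` occurs in the echelon form. An element of the
span can therefore be cancelled at its leading term by a new row or by an element of `bs`, without
leaving the span, and so reduces to `0` (`redStar_zero_of_mem_span`). The S-polynomials of the
treated pairs lie in this span.

For the loop, reduction to `0` is weakened to `IsResolved`: the S-polynomial is a combination of
multiples with leading terms below the least common multiple. The chain and product criteria give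
this by explicit identities, and it suffices for Buchberger's criterion
(`isReducible_of_isResolved`). The invariant is that any two distinct basis elements form a waiting
or a resolved pair. At the end, all leading terms of the submodule are reducible, so normal forms
are unique and reduction is confluent. Termination is Dickson's lemma applied to the new leading
terms (`exists_gbStep_iterate`). -/

namespace F4

open Set

/-! ### Terms, divisibility and Dickson gradings -/

section Terms

variable {α κ : Type*} [CancelCommMonoid α]

@[simp] theorem stimes_pp (t : α) (v : Term α κ) : (stimes t v).pp = t * v.pp := rfl

@[simp] theorem stimes_comp (t : α) (v : Term α κ) : (stimes t v).comp = v.comp := rfl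

theorem stimes_stimes (s t : α) (v : Term α κ) : stimes s (stimes t v) = stimes (s * t) v := by
  ext <;> simp [mul_assoc]

@[simp] theorem stimes_one (v : Term α κ) : stimes 1 v = v := by
  ext <;> simp

theorem stimes_injective (t : α) : Function.Injective (stimes t : Term α κ → Term α κ) := by
  intro v w h
  rw [Term.ext_iff] at h ⊢
  simpa using h

theorem Term.Dvd.stimes (t : α) (v : Term α κ) : v.Dvd (stimes t v) :=
  ⟨rfl, Dvd.intro_left _ rfl⟩

theorem Term.Dvd.exists_stimes {v w : Term α κ} (h : v.Dvd w) : ∃ t : α, F4.stimes t v = w := by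
  obtain ⟨h1, t, h2⟩ := h
  exact ⟨t, Term.ext (by rw [stimes_pp, mul_comm, h2]) h1⟩

theorem ppDiv_mul {t s : α} (h : s ∣ t) : ppDiv t s * s = t := by
  rw [ppDiv, dif_pos h, mul_comm]
  exact h.choose_spec.symm

theorem stimes_ppDiv {v w : Term α κ} (h : v.Dvd w) : stimes (ppDiv w.pp v.pp) v = w :=
  Term.ext (ppDiv_mul h.2) h.1

/-- A Dickson grading of the power-products. -/
structure IsDicksonGrading (d : α → ℕ) : Prop where
  map_mul : ∀ s t : α, d (s * t) = max (d s) (d t)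
  dickson : ∀ (m : ℕ) (s : ℕ → α), (∀ i, d (s i) ≤ m) → ∃ i j : ℕ, i < j ∧ s i ∣ s j

theorem IsDicksonGrading.mono {d : α → ℕ} (hd : IsDicksonGrading d) {s t : α} (h : s ∣ t) :
    d s ≤ d t := by
  obtain ⟨u, rfl⟩ := h
  rw [hd.map_mul]
  exact le_max_left _ _

/-- The terms whose power-products have degree at most `m`. -/
def degreeLE (κ : Type*) (d : α → ℕ) (m : ℕ) : Set (Term α κ) := {v | d v.pp ≤ m}

omit [CancelCommMonoid α] in
theorem degreeLE_mono (d : α → ℕ) {m n : ℕ} (h : m ≤ n) :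
    degreeLE κ d m ⊆ degreeLE κ d n := fun _ hv => le_trans hv h

theorem IsDicksonGrading.partiallyWellOrderedOn {d : α → ℕ} (hd : IsDicksonGrading d) (m : ℕ) :
    {s : α | d s ≤ m}.PartiallyWellOrderedOn (· ∣ ·) := by
  rw [Set.partiallyWellOrderedOn_iff_exists_lt]
  exact fun f hf => hd.dickson m f hf

/-- Divisibility is a well-quasi-order on the terms of bounded degree whose components lie in a
finite set. -/
theorem IsDicksonGrading.exists_lt_dvd {d : α → ℕ} (hd : IsDicksonGrading d) (m : ℕ) {C : Set κ}
    (hC : C.Finite) (v : ℕ → Term α κ) (hv : ∀ n, v n ∈ degreeLE κ d m)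
    (hvC : ∀ n, (v n).comp ∈ C) :
    ∃ i j : ℕ, i < j ∧ (v i).Dvd (v j) := by
  -- Equality is a well-quasi-order on the finite set `C`; its product with divisibility of
  -- power-products is exactly `Term.Dvd`.
  have h := (hC.partiallyWellOrderedOn (r := (· = ·))).prod (hd.partiallyWellOrderedOn m)
  obtain ⟨i, j, hij, h⟩ := h.exists_lt (f := fun n => ((v n).comp, (v n).pp))
    (fun n => ⟨hvC n, hv n⟩)
  exact ⟨i, j, hij, h⟩

end Terms

theorem exists_isDicksonGrading (α : Type*) [CancelCommMonoid α] [GradedDicksonPowerprod α] :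
    ∃ d : α → ℕ, IsDicksonGrading d := by
  obtain ⟨d, h1, h2⟩ := GradedDicksonPowerprod.exists_dicksonGrading (α := α)
  exact ⟨d, h1, h2⟩

/-! ### Well-foundedness of the term order in bounded degree -/

section TermOrder

variable {α κ : Type*} [CancelCommMonoid α] [LinearOrder α] [LinearOrder κ]
  [LinearOrder (Term α κ)] [IsTermOrder α κ]

theorem stimes_strictMono (t : α) : StrictMono (stimes t : Term α κ → Term α κ) :=
  Monotone.strictMono_of_injective (fun v w h => IsTermOrder.stimes_le_stimes t v w h)
    (stimes_injective t)

theorem le_of_ppDvd (κ : Type*) [LinearOrder κ] [LinearOrder (Term α κ)] [IsTermOrder α κ]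
    {s t : α} (h : s ∣ t) : s ≤ t := by
  obtain ⟨u, rfl⟩ := h
  have := IsTermOrder.mul_le_mul κ 1 u s (IsTermOrder.one_le κ u)
  rwa [one_mul, mul_comm] at this

/-- The term order is well-founded on terms of bounded degree. -/
theorem IsDicksonGrading.wellFoundedOn [WellFoundedLT κ] {d : α → ℕ} (hd : IsDicksonGrading d)
    (m : ℕ) : (degreeLE κ d m).WellFoundedOn (· < ·) := by
  -- The linear term order contains the product of the well-order on components and divisibility on
  -- power-products. That product is a well-quasi-order in bounded degree, so the term order is
  -- well-founded there.
  have h1 : (univ : Set κ).PartiallyWellOrderedOn (· ≤ ·) := Set.isPWO_of_wellQuasiOrderedLE _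
  have h := h1.prod (hd.partiallyWellOrderedOn m)
  have h2 : (degreeLE κ d m).PartiallyWellOrderedOn (· ≤ ·) := by
    rw [Set.partiallyWellOrderedOn_iff_exists_lt]
    intro v hv
    obtain ⟨i, j, hij, h⟩ := h.exists_lt (f := fun n => ((v n).comp, (v n).pp))
      (fun n => ⟨mem_univ _, hv n⟩)
    exact ⟨i, j, hij, IsTermOrder.term_le_term _ _ (le_of_ppDvd κ h.2) h.1⟩
  exact Set.IsPWO.isWF h2

end TermOrder

/-! ### Multiplication by power-products -/

section Shift

variable {α κ K : Type*} [CancelCommMonoid α] [Field K]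

/-- Multiplication of vector-polynomials by a power-product, as a linear map. -/
noncomputable def shift (t : α) : VPoly α κ K →ₗ[K] VPoly α κ K :=
  Finsupp.lmapDomain K K (stimes t)

theorem monomMult_eq (c : K) (t : α) (p : VPoly α κ K) : monomMult c t p = c • shift t p := rfl

@[simp] theorem shift_apply_stimes (t : α) (p : VPoly α κ K) (v : Term α κ) :
    shift t p (stimes t v) = p v :=
  Finsupp.mapDomain_apply (stimes_injective t) p v

theorem support_shift (t : α) (p : VPoly α κ K) {w : Term α κ} (hw : w ∈ (shift t p).support) :
    ∃ v ∈ p.support, stimes t v = w := by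
  classical
  have := Finsupp.mapDomain_support hw
  simpa using this

@[simp] theorem shift_single (t : α) (v : Term α κ) (c : K) :
    shift t (Finsupp.single v c) = Finsupp.single (stimes t v) c :=
  Finsupp.mapDomain_single

theorem shift_shift (s t : α) (p : VPoly α κ K) : shift s (shift t p) = shift (s * t) p := by
  simp only [shift, Finsupp.lmapDomain_apply]
  rw [← Finsupp.mapDomain_comp]
  congr 1
  funext v
  exact stimes_stimes s t v

@[simp] theorem shift_one (p : VPoly α κ K) : shift 1 p = p := by
  have : (stimes (1 : α) : Term α κ → Term α κ) = id := funext stimes_one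
  simp [shift, this]

theorem shift_injective (t : α) : Function.Injective (shift t : VPoly α κ K →ₗ[K] VPoly α κ K) :=
  Finsupp.mapDomain_injective (stimes_injective t)

theorem shift_ne_zero (t : α) {p : VPoly α κ K} (hp : p ≠ 0) : shift t p ≠ 0 := by
  rwa [Ne, map_eq_zero_iff _ (shift_injective t)]

end Shift

/-! ### Leading terms -/

section LeadingTerm

variable {α κ K : Type*} [CancelCommMonoid α] [Field K] [Nonempty κ] [LinearOrder (Term α κ)]

theorem lt_mem_support {p : VPoly α κ K} (hp : p ≠ 0) : lt p ∈ p.support := by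
  have h : p.support.Nonempty := Finsupp.support_nonempty_iff.2 hp
  rw [lt, dif_pos h]
  exact Finset.max'_mem _ _

theorem le_lt {p : VPoly α κ K} {v : Term α κ} (hv : v ∈ p.support) : v ≤ lt p := by
  have h : p.support.Nonempty := ⟨v, hv⟩
  rw [lt, dif_pos h]
  exact Finset.le_max' _ _ hv

theorem lc_ne_zero {p : VPoly α κ K} (hp : p ≠ 0) : lc p ≠ 0 :=
  Finsupp.mem_support_iff.1 (lt_mem_support hp)

theorem lt_eq_of {p : VPoly α κ K} {v : Term α κ} (hv : p v ≠ 0) (h : ∀ w ∈ p.support, w ≤ v) :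
    lt p = v := by
  have hp : p ≠ 0 := by rintro rfl; simp at hv
  exact le_antisymm (h _ (lt_mem_support hp)) (le_lt (Finsupp.mem_support_iff.2 hv))

theorem lt_smul {c : K} (hc : c ≠ 0) (p : VPoly α κ K) : lt (c • p) = lt p := by
  by_cases hp : p = 0
  · simp [hp]
  · refine lt_eq_of ?_ fun w hw => le_lt (Finsupp.support_smul hw)
    simpa using ⟨hc, lc_ne_zero hp⟩

variable [LinearOrder α] [LinearOrder κ] [IsTermOrder α κ]

theorem support_shift_le {t : α} {p : VPoly α κ K} {w : Term α κ} (hw : w ∈ (shift t p).support) :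
    w ≤ stimes t (lt p) := by
  obtain ⟨v, hv, rfl⟩ := support_shift t p hw
  exact IsTermOrder.stimes_le_stimes _ _ _ (le_lt hv)

theorem lt_shift (t : α) {p : VPoly α κ K} (hp : p ≠ 0) : lt (shift t p) = stimes t (lt p) :=
  lt_eq_of (by rw [shift_apply_stimes]; exact lc_ne_zero hp) fun _ hw => support_shift_le hw

end LeadingTerm

/-! ### Spans of multiples with controlled leading terms -/

section MultSpan

variable {α κ K : Type*} [CancelCommMonoid α] [Field K] [Nonempty κ] [LinearOrder (Term α κ)]

/-- The linear combinations of multiples of elements of `F` with leading terms in `S`. -/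
noncomputable def multSpan (F : Set (VPoly α κ K)) (S : Set (Term α κ)) :
    Submodule K (VPoly α κ K) :=
  Submodule.span K {g | ∃ f ∈ F, f ≠ 0 ∧ ∃ t : α, stimes t (lt f) ∈ S ∧ g = shift t f}

theorem shift_mem_multSpan {F : Set (VPoly α κ K)} {S : Set (Term α κ)} {f : VPoly α κ K}
    (hf : f ∈ F) (hf0 : f ≠ 0) {t : α} (ht : stimes t (lt f) ∈ S) : shift t f ∈ multSpan F S :=
  Submodule.subset_span ⟨f, hf, hf0, t, ht, rfl⟩

theorem multSpan_mono {F G : Set (VPoly α κ K)} {S T : Set (Term α κ)} (hFG : F ⊆ G)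
    (hST : S ⊆ T) : multSpan F S ≤ multSpan G T :=
  Submodule.span_mono fun _ ⟨f, hf, hf0, t, ht, h⟩ => ⟨f, hFG hf, hf0, t, hST ht, h⟩

theorem mem_multSpan_mono {F G : Set (VPoly α κ K)} {S T : Set (Term α κ)} (hFG : F ⊆ G)
    (hST : S ⊆ T) {p : VPoly α κ K} (hp : p ∈ multSpan F S) : p ∈ multSpan G T :=
  multSpan_mono hFG hST hp

theorem shift_multSpan {F : Set (VPoly α κ K)} {S T : Set (Term α κ)} {u : α}
    (h : ∀ v ∈ S, stimes u v ∈ T) {p : VPoly α κ K} (hp : p ∈ multSpan F S) :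
    shift u p ∈ multSpan F T := by
  have : multSpan F S ≤ (multSpan F T).comap (shift u) := by
    refine Submodule.span_le.2 ?_
    rintro _ ⟨f, hf, hf0, t, ht, rfl⟩
    rw [SetLike.mem_coe, Submodule.mem_comap, shift_shift]
    exact shift_mem_multSpan hf hf0 (by rw [← stimes_stimes]; exact h _ ht)
  exact this hp

/-- Turns the inductively generated set into a `K`-subspace, so that the submodule can be handled by
span induction and compared with the bounded spans `multSpan F S`. -/
theorem pmdl_eq (F : Set (VPoly α κ K)) : pmdl F = (multSpan F univ : Set (VPoly α κ K)) := by
  ext p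
  constructor
  · intro h
    induction h with
    | zero => exact zero_mem _
    | base b hb =>
      by_cases h0 : b = 0
      · rw [h0]; exact zero_mem _
      · simpa using shift_mem_multSpan (t := 1) hb h0 (mem_univ _)
    | add p q _ _ hp hq => exact add_mem hp hq
    | monomMult c t p _ hp =>
      exact Submodule.smul_mem _ _ (shift_multSpan (fun _ _ => mem_univ _) hp)
  · intro h
    refine Submodule.span_induction ?_ pmdl.zero (fun p q _ _ hp hq => pmdl.add p q hp hq) ?_ h
    · rintro _ ⟨f, hf, -, t, -, rfl⟩
      have h := pmdl.monomMult 1 t f (pmdl.base f hf)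
      rwa [monomMult_eq, one_smul] at h
    · intro c p _ hp
      have h := pmdl.monomMult c 1 p hp
      rwa [monomMult_eq, shift_one] at h

theorem mem_pmdl {F : Set (VPoly α κ K)} {p : VPoly α κ K} : p ∈ pmdl F ↔ p ∈ multSpan F univ := by
  rw [pmdl_eq]; rfl

/-- A combination involves finitely many multiples, so their leading terms have a common degree
bound. This moves arguments into the region where the term order is well-founded. -/
theorem multSpan_inter_degreeLE {d : α → ℕ} {F : Set (VPoly α κ K)} {S : Set (Term α κ)}
    {p : VPoly α κ K} (hp : p ∈ multSpan F S) :
    ∃ m, p ∈ multSpan F (S ∩ degreeLE κ d m) := by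
  refine Submodule.span_induction ?_ ⟨0, zero_mem _⟩ ?_ ?_ hp
  · rintro _ ⟨f, hf, hf0, t, ht, rfl⟩
    exact ⟨_, shift_mem_multSpan hf hf0 ⟨ht, le_refl (d (stimes t (lt f)).pp)⟩⟩
  · rintro p q - - ⟨m, hm⟩ ⟨n, hn⟩
    exact ⟨max m n, add_mem
      (multSpan_mono subset_rfl (inter_subset_inter_right _ (degreeLE_mono d (le_max_left _ _))) hm)
      (multSpan_mono subset_rfl
        (inter_subset_inter_right _ (degreeLE_mono d (le_max_right _ _))) hn)⟩
  · rintro c p - ⟨m, hm⟩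
    exact ⟨m, Submodule.smul_mem _ _ hm⟩

/-- The largest leading term used in a combination serves as `v`. The empty combination uses none,
whence the case `p = 0`. -/
theorem multSpan_inter_Iic {F : Set (VPoly α κ K)} {S : Set (Term α κ)}
    {p : VPoly α κ K} (hp : p ∈ multSpan F S) :
    p = 0 ∨ ∃ v ∈ S, p ∈ multSpan F (S ∩ Iic v) := by
  refine Submodule.span_induction ?_ (Or.inl rfl) ?_ ?_ hp
  · rintro _ ⟨f, hf, hf0, t, ht, rfl⟩
    exact Or.inr ⟨_, ht, shift_mem_multSpan hf hf0 ⟨ht, le_rfl⟩⟩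
  · rintro p q - - (rfl | ⟨v, hv, hp⟩) (rfl | ⟨w, hw, hq⟩)
    · simp
    · exact Or.inr ⟨w, hw, by simpa using hq⟩
    · exact Or.inr ⟨v, hv, by simpa using hp⟩
    · refine Or.inr ⟨max v w, ?_, add_mem
        (multSpan_mono subset_rfl
          (inter_subset_inter_right _ (Iic_subset_Iic.2 (le_max_left v w))) hp)
        (multSpan_mono subset_rfl
          (inter_subset_inter_right _ (Iic_subset_Iic.2 (le_max_right v w))) hq)⟩
      rcases max_choice v w with h | h <;> rwa [h]
  · rintro c p - (rfl | ⟨v, hv, hp⟩)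
    · simp
    · exact Or.inr ⟨v, hv, Submodule.smul_mem _ _ hp⟩

variable [LinearOrder α] [LinearOrder κ] [IsTermOrder α κ]

/-- All terms of a multiple lie below its leading term, hence in the lower set `S`. -/
theorem support_subset_of_mem_multSpan {F : Set (VPoly α κ K)} {S : Set (Term α κ)}
    (hS : IsLowerSet S) {p : VPoly α κ K} (hp : p ∈ multSpan F S) : (p.support : Set _) ⊆ S := by
  have : multSpan F S ≤ Finsupp.supported K K S := by
    refine Submodule.span_le.2 ?_
    rintro _ ⟨f, hf, hf0, t, ht, rfl⟩ w hw
    exact hS (support_shift_le hw) ht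
  exact this hp

omit [LinearOrder α] [LinearOrder κ] [IsTermOrder α κ] in
theorem Red.sub_mem {F : Set (VPoly α κ K)} {p q : VPoly α κ K} (h : Red F p q)
    {S : Set (Term α κ)} (hp : (p.support : Set _) ⊆ S) : p - q ∈ multSpan F S := by
  obtain ⟨f, hf, t, hf0, ht, rfl⟩ := h
  rw [sub_sub_cancel, monomMult_eq]
  exact Submodule.smul_mem _ _ (shift_mem_multSpan hf hf0 (hp (Finsupp.mem_support_iff.2 ht)))

omit [CancelCommMonoid α] [Nonempty κ] [LinearOrder (Term α κ)] [LinearOrder α] [LinearOrder κ]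
  [IsTermOrder α κ] in
theorem support_sub_subset {S : Set (Term α κ)} {p q : VPoly α κ K}
    (hp : (p.support : Set _) ⊆ S) (hq : (q.support : Set _) ⊆ S) :
    ((p - q).support : Set _) ⊆ S :=
  (Finsupp.supported K K S).sub_mem hp hq

/-- A reduction step subtracts a multiple whose leading term occurs in the current polynomial. The
two conclusions must be proved together: the support bound on one polynomial puts the leading term
used in the next step into `S`. -/
theorem RedStar.sub_mem_and_support {F : Set (VPoly α κ K)} {p q : VPoly α κ K}
    (h : RedStar F p q) {S : Set (Term α κ)} (hS : IsLowerSet S) (hp : (p.support : Set _) ⊆ S) :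
    p - q ∈ multSpan F S ∧ (q.support : Set _) ⊆ S := by
  induction h with
  | refl => simpa using hp
  | tail _ hr ih =>
    have h1 := hr.sub_mem ih.2
    refine ⟨by simpa using add_mem ih.1 h1, ?_⟩
    simpa using support_sub_subset ih.2 (support_subset_of_mem_multSpan hS h1)

theorem RedStar.mem_multSpan {F : Set (VPoly α κ K)} {p : VPoly α κ K}
    (h : RedStar F p 0) {S : Set (Term α κ)} (hS : IsLowerSet S) (hp : (p.support : Set _) ⊆ S) :
    p ∈ multSpan F S := by
  simpa using (h.sub_mem_and_support hS hp).1

end MultSpan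

theorem RedStar.mono {α κ K : Type*} [CancelCommMonoid α] [Field K] [Nonempty κ]
    [LinearOrder (Term α κ)] {F G : Set (VPoly α κ K)} (hFG : F ⊆ G) {p q : VPoly α κ K}
    (h : RedStar F p q) : RedStar G p q :=
  Relation.ReflTransGen.mono
    (show Red F ≤ Red G from fun _ _ ⟨f, hf, ht⟩ => ⟨f, hFG hf, ht⟩) _ _ h

/-! ### Normal forms and confluence -/

section Groebner

variable {α κ K : Type*} [CancelCommMonoid α] [Field K] [Nonempty κ] [LinearOrder (Term α κ)]
  [LinearOrder α] [LinearOrder κ] [IsTermOrder α κ]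

/-- The term `v` is divisible by the leading term of a non-zero element of `F`. -/
def IsReducible (F : Set (VPoly α κ K)) (v : Term α κ) : Prop :=
  ∃ f ∈ F, f ≠ 0 ∧ (lt f).Dvd v

/-- Reducing `p` at the term `v` cancels `v` and changes only smaller terms. -/
theorem exists_red {F : Set (VPoly α κ K)} {p f : VPoly α κ K} {v : Term α κ} (hf : f ∈ F)
    (hf0 : f ≠ 0) (h : (lt f).Dvd v) (hv : v ∈ p.support) :
    ∃ (c : K) (t : α), stimes t (lt f) = v ∧ Red F p (p - c • shift t f) ∧
      (p - c • shift t f) v = 0 ∧ ∀ w, v < w → (p - c • shift t f) w = p w := by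
  obtain ⟨t, rfl⟩ := h.exists_stimes
  refine ⟨p (stimes t (lt f)) / lc f, t, rfl,
    ⟨f, hf, t, hf0, Finsupp.mem_support_iff.1 hv, rfl⟩, ?_, fun w hw => ?_⟩
  · have : f (lt f) ≠ 0 := lc_ne_zero hf0
    simp only [Finsupp.sub_apply, Finsupp.smul_apply, shift_apply_stimes, smul_eq_mul, lc]
    rw [div_mul_cancel₀ _ this, sub_self]
  · have : shift t f w = 0 := by
      by_contra hne
      exact absurd (support_shift_le (Finsupp.mem_support_iff.2 hne)) (not_le.2 hw)
    simp [this]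

/-- Always reducing at the largest reducible term pushes the reducible terms down, and the degree
bound makes this descent finite. -/
theorem exists_normalForm [WellFoundedLT κ] {d : α → ℕ} (hd : IsDicksonGrading d)
    {F : Set (VPoly α κ K)} {m : ℕ}
    (hF : ∀ f ∈ F, (f.support : Set (Term α κ)) ⊆ degreeLE κ d m) {p : VPoly α κ K}
    (hp : (p.support : Set (Term α κ)) ⊆ degreeLE κ d m) :
    ∃ r, RedStar F p r ∧ ∀ v ∈ r.support, ¬ IsReducible F v := by
  classical
  have key : ∀ v, v ∈ degreeLE κ d m → ∀ p : VPoly α κ K,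
      (p.support : Set (Term α κ)) ⊆ degreeLE κ d m →
      (∀ w ∈ p.support, IsReducible F w → w ≤ v) →
      ∃ r, RedStar F p r ∧ ∀ v ∈ r.support, ¬ IsReducible F v := by
    intro v hv
    refine (hd.wellFoundedOn m).induction hv
      (P := fun v => ∀ p : VPoly α κ K, (p.support : Set (Term α κ)) ⊆ degreeLE κ d m →
        (∀ w ∈ p.support, IsReducible F w → w ≤ v) →
        ∃ r, RedStar F p r ∧ ∀ v ∈ r.support, ¬ IsReducible F v) ?_
    intro v hv ih p hp hpv
    -- One reduction at `v` if `v` is a reducible term of `p`, none otherwise; in both cases the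
    -- remaining reducible terms are below `v`, and the largest of them is the next bound.
    obtain ⟨q, hpq, hq, hqv⟩ : ∃ q, RedStar F p q ∧
        (q.support : Set (Term α κ)) ⊆ degreeLE κ d m ∧
        ∀ w ∈ q.support, IsReducible F w → w < v := by
      by_cases h : v ∈ p.support ∧ IsReducible F v
      · obtain ⟨hvp, f, hf, hf0, hfv⟩ := h
        obtain ⟨c, t, ht, hred, h0, h1⟩ := exists_red hf hf0 hfv hvp
        refine ⟨_, Relation.ReflTransGen.single hred, support_sub_subset hp fun w hw => ?_,
          fun w hw hwr => ?_⟩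
        · obtain ⟨u, hu, rfl⟩ := support_shift t f (Finsupp.support_smul hw)
          -- The cofactor divides the power-product of `v`, so multiplying by it cannot raise the
          -- degree above `m`.
          have h2 : d t ≤ m := by
            refine (hd.mono (Dvd.intro _ rfl)).trans (?_ : d (t * (lt f).pp) ≤ m)
            rw [← stimes_pp, ht]; exact hp hvp
          change d (t * u.pp) ≤ m
          rw [hd.map_mul]
          exact max_le h2 (hF f hf hu)
        · rw [Finsupp.mem_support_iff] at hw
          by_contra hlt
          rcases (not_lt.1 hlt).eq_or_lt with h | h
          · exact hw (h ▸ h0)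
          · rw [h1 w h] at hw
            exact hlt.elim ((hpv w (Finsupp.mem_support_iff.2 hw) hwr).lt_of_ne h.ne')
      · refine ⟨p, Relation.ReflTransGen.refl, hp, fun w hw hwr => (hpv w hw hwr).lt_of_ne ?_⟩
        rintro rfl
        exact h ⟨hw, hwr⟩
    by_cases hne : (q.support.filter (IsReducible F)).Nonempty
    · have hmax := Finset.max'_mem _ hne
      rw [Finset.mem_filter] at hmax
      obtain ⟨r, hr, hr'⟩ := ih _ (hq hmax.1) (hqv _ hmax.1 hmax.2) q hq
        (fun w hw hwr => Finset.le_max' _ _ (Finset.mem_filter.2 ⟨hw, hwr⟩))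
      exact ⟨r, Relation.ReflTransGen.trans hpq hr, hr'⟩
    · refine ⟨q, hpq, fun w hw hwr => hne ⟨w, Finset.mem_filter.2 ⟨hw, hwr⟩⟩⟩
  by_cases h0 : p = 0
  · exact ⟨p, Relation.ReflTransGen.refl, by simp [h0]⟩
  · exact key (lt p) (hp (lt_mem_support h0)) p hp fun w hw _ => le_lt hw

omit [CancelCommMonoid α] [Nonempty κ] [LinearOrder (Term α κ)] [LinearOrder α] [LinearOrder κ]
  [IsTermOrder α κ] in
theorem exists_support_subset_degreeLE (d : α → ℕ) {F : Set (VPoly α κ K)} (hF : F.Finite) :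
    ∃ m, ∀ f ∈ F, (f.support : Set (Term α κ)) ⊆ degreeLE κ d m := by
  have h : (⋃ f ∈ F, (f.support : Set (Term α κ))).Finite :=
    hF.biUnion fun f _ => f.support.finite_toSet
  obtain ⟨m, hm⟩ := (h.image fun v => d v.pp).bddAbove
  exact ⟨m, fun f hf v hv => hm ⟨v, mem_biUnion hf hv, rfl⟩⟩

/-- A finite set is a Gröbner basis if the leading terms of all non-zero elements of the submodule
it generates are reducible. -/
theorem isGroebnerBasis_of_isReducible [GradedDicksonPowerprod α] [WellFoundedLT κ]
    {F : Set (VPoly α κ K)} (hF : F.Finite)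
    (h : ∀ p ∈ multSpan F univ, p ≠ 0 → IsReducible F (lt p)) : IsGroebnerBasis F := by
  obtain ⟨d, hd⟩ := exists_isDicksonGrading α
  intro p q₁ q₂ h₁ h₂
  -- One degree bound for `F` and both reducts, so that both have normal forms.
  obtain ⟨m, hm⟩ := exists_support_subset_degreeLE d ((hF.insert q₁).insert q₂)
  have hm' : ∀ f ∈ F, (f.support : Set (Term α κ)) ⊆ degreeLE κ d m :=
    fun f hf => hm f (Or.inr (Or.inr hf))
  obtain ⟨r₁, hr₁, hn₁⟩ := exists_normalForm hd hm' (hm q₁ (Or.inr (Or.inl rfl)))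
  obtain ⟨r₂, hr₂, hn₂⟩ := exists_normalForm hd hm' (hm q₂ (Or.inl rfl))
  have e₁ := (RedStar.sub_mem_and_support (h₁.trans hr₁) isLowerSet_univ (subset_univ _)).1
  have e₂ := (RedStar.sub_mem_and_support (h₂.trans hr₂) isLowerSet_univ (subset_univ _)).1
  have e : r₁ - r₂ ∈ multSpan F univ := by simpa using sub_mem e₂ e₁
  have : r₁ = r₂ := by
    by_contra hne
    have h0 : r₁ - r₂ ≠ 0 := sub_ne_zero.2 hne
    have hred := h _ e h0
    classical
    -- The leading term of the difference occurs in one of the two normal forms, yet it is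
    -- reducible.
    rcases Finset.mem_union.1 (Finsupp.support_sub (lt_mem_support h0)) with hs | hs
    · exact hn₁ _ hs hred
    · exact hn₂ _ hs hred
  exact ⟨r₁, hr₁, this ▸ hr₂⟩

/-! ### S-polynomials and Buchberger's criterion -/

variable [GradedDicksonPowerprod α]

/-- The least common multiple of the leading terms of two polynomials whose leading terms have the
same component. -/
noncomputable def lcmTerm (p q : VPoly α κ K) : Term α κ :=
  ⟨GradedDicksonPowerprod.lcm (lp p) (lp q), (lt p).comp⟩

omit [LinearOrder α] [LinearOrder κ] [IsTermOrder α κ] in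
theorem lt_dvd_lcmTerm (p q : VPoly α κ K) : (lt p).Dvd (lcmTerm p q) :=
  ⟨rfl, GradedDicksonPowerprod.dvd_lcm _ _⟩

omit [LinearOrder α] [LinearOrder κ] [IsTermOrder α κ] in
theorem lcmTerm_comm {p q : VPoly α κ K} (h : (lt p).comp = (lt q).comp) :
    lcmTerm p q = lcmTerm q p :=
  Term.ext (GradedDicksonPowerprod.lcm_comm _ _) h

omit [LinearOrder α] [LinearOrder κ] [IsTermOrder α κ] in
theorem lcmTerm_dvd {p q : VPoly α κ K} {v : Term α κ} (hp : (lt p).Dvd v) (hq : (lt q).Dvd v) :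
    (lcmTerm p q).Dvd v :=
  ⟨hp.1, GradedDicksonPowerprod.lcm_dvd _ _ _ hp.2 hq.2⟩

omit [LinearOrder α] [LinearOrder κ] [IsTermOrder α κ] in
theorem spoly_eq {p q : VPoly α κ K} (h : (lt p).comp = (lt q).comp) :
    ∃ s t : α, stimes s (lt p) = lcmTerm p q ∧ stimes t (lt q) = lcmTerm p q ∧
      spoly p q = (1 / lc p) • shift s p - (1 / lc q) • shift t q := by
  refine ⟨_, _, stimes_ppDiv (lt_dvd_lcmTerm p q),
    stimes_ppDiv (lcmTerm_comm h ▸ lt_dvd_lcmTerm q p), ?_⟩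
  rw [spoly, if_pos h]
  rfl

omit [LinearOrder α] [LinearOrder κ] [IsTermOrder α κ] in
/-- A difference of monic multiples with the same leading term is a multiple of the
S-polynomial. -/
theorem exists_shift_spoly {p q : VPoly α κ K} {s t : α} {v : Term α κ}
    (hs : stimes s (lt p) = v) (ht : stimes t (lt q) = v) :
    ∃ u : α, stimes u (lcmTerm p q) = v ∧
      shift u (spoly p q) = (1 / lc p) • shift s p - (1 / lc q) • shift t q := by
  have hp : (lt p).Dvd v := hs ▸ Term.Dvd.stimes _ _
  have hq : (lt q).Dvd v := ht ▸ Term.Dvd.stimes _ _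
  obtain ⟨u, hu⟩ := (lcmTerm_dvd hp hq).exists_stimes
  obtain ⟨s', t', hs', ht', h⟩ := spoly_eq (hp.1.trans hq.1.symm)
  have cancel : ∀ {a b : α} {w : Term α κ}, stimes a w = stimes b w → a = b := fun h =>
    mul_right_cancel (congrArg Term.pp h)
  have e1 : u * s' = s := by
    apply cancel (w := lt p); rw [← stimes_stimes, hs', hu, hs]
  have e2 : u * t' = t := by
    apply cancel (w := lt q); rw [← stimes_stimes, ht', hu, ht]
  exact ⟨u, hu, by rw [h, map_sub, map_smul, map_smul, shift_shift, shift_shift, e1, e2]⟩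

/-- Both summands have leading term `lcmTerm p q` with coefficient `1`, so this term cancels. -/
theorem support_spoly {p q : VPoly α κ K} (hp : p ≠ 0) (hq : q ≠ 0)
    (h : (lt p).comp = (lt q).comp) :
    ((spoly p q).support : Set (Term α κ)) ⊆ Iio (lcmTerm p q) := by
  obtain ⟨s, t, hs, ht, e⟩ := spoly_eq h
  intro v hv
  have hle : v ∈ Iic (lcmTerm p q) := by
    rw [e] at hv
    refine support_sub_subset (fun w hw => ?_) (fun w hw => ?_) hv
    · rw [← hs]; exact support_shift_le (Finsupp.support_smul hw)
    · rw [← ht]; exact support_shift_le (Finsupp.support_smul hw)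
  refine lt_of_le_of_ne hle ?_
  rintro rfl
  rw [Finset.mem_coe, Finsupp.mem_support_iff] at hv
  apply hv
  have e1 : shift s p (lcmTerm p q) = lc p := by rw [← hs, shift_apply_stimes]; rfl
  have e2 : shift t q (lcmTerm p q) = lc q := by rw [← ht, shift_apply_stimes]; rfl
  simp [e, e1, e2, lc_ne_zero hp, lc_ne_zero hq]

/-- The S-polynomial of `p` and `q` is a combination of multiples of elements of `F` with leading
terms below the least common multiple of the leading terms. -/
def IsResolved (F : Set (VPoly α κ K)) (p q : VPoly α κ K) : Prop :=
  p ≠ 0 → q ≠ 0 → (lt p).comp = (lt q).comp → spoly p q ∈ multSpan F (Iio (lcmTerm p q))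

omit [LinearOrder α] [LinearOrder κ] [IsTermOrder α κ] in
theorem IsResolved.mono {F G : Set (VPoly α κ K)} (h : F ⊆ G) {p q : VPoly α κ K}
    (hpq : IsResolved F p q) : IsResolved G p q := fun hp hq hc =>
  multSpan_mono h subset_rfl (hpq hp hq hc)

/-- The S-polynomial lives strictly below the least common multiple, and reduction never leaves a
lower set. -/
theorem isResolved_of_redStar {F : Set (VPoly α κ K)} {p q : VPoly α κ K}
    (h : RedStar F (spoly p q) 0) : IsResolved F p q := fun hp hq hc =>
  h.mem_multSpan (isLowerSet_Iio _) (support_spoly hp hq hc)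

omit [LinearOrder α] [LinearOrder κ] [IsTermOrder α κ] in
theorem IsResolved.symm {F : Set (VPoly α κ K)} {p q : VPoly α κ K}
    (h : IsResolved F p q) : IsResolved F q p := by
  intro hq hp hc
  have := neg_mem (h hp hq hc.symm)
  rw [lcmTerm_comm hc]
  convert this using 1
  simp only [spoly, if_pos hc, if_pos hc.symm, GradedDicksonPowerprod.lcm_comm (lp p), neg_sub]

omit [LinearOrder α] [LinearOrder κ] [IsTermOrder α κ] in
theorem isResolved_self (F : Set (VPoly α κ K)) (p : VPoly α κ K) : IsResolved F p p := by
  intro _ _ _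
  simp [spoly]

/-- Buchberger's criterion. -/
theorem isReducible_of_isResolved [WellFoundedLT κ] {F : Set (VPoly α κ K)} (hF : F.Finite)
    (hres : ∀ p ∈ F, ∀ q ∈ F, IsResolved F p q) {p : VPoly α κ K} (hp : p ∈ multSpan F univ)
    (hp0 : p ≠ 0) : IsReducible F (lt p) := by
  obtain ⟨d, hd⟩ := exists_isDicksonGrading α
  -- The hypotheses stand inside the existential so that `choose` gives a degree bound for every
  -- pair; its values on the finite set `F ×ˢ F` are then bounded.
  have hb : ∀ x : VPoly α κ K × VPoly α κ K, ∃ m, x.1 ∈ F → x.2 ∈ F → x.1 ≠ 0 → x.2 ≠ 0 →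
      (lt x.1).comp = (lt x.2).comp →
      spoly x.1 x.2 ∈ multSpan F (Iio (lcmTerm x.1 x.2) ∩ degreeLE κ d m) := by
    intro x
    by_cases h : x.1 ∈ F ∧ x.2 ∈ F ∧ x.1 ≠ 0 ∧ x.2 ≠ 0 ∧ (lt x.1).comp = (lt x.2).comp
    · obtain ⟨m, hm⟩ := multSpan_inter_degreeLE (d := d)
        (hres x.1 h.1 x.2 h.2.1 h.2.2.1 h.2.2.2.1 h.2.2.2.2)
      exact ⟨m, fun _ _ _ _ _ => hm⟩
    · exact ⟨0, fun h1 h2 h3 h4 h5 => (h ⟨h1, h2, h3, h4, h5⟩).elim⟩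
  choose b hb using hb
  obtain ⟨m₁, hm₁⟩ := ((hF.prod hF).image b).bddAbove
  obtain ⟨m₂, hm₂⟩ := multSpan_inter_degreeLE (d := d) hp
  set m := max m₁ m₂
  have hm : ∀ f ∈ F, ∀ g ∈ F, f ≠ 0 → g ≠ 0 → (lt f).comp = (lt g).comp →
      spoly f g ∈ multSpan F (degreeLE κ d m ∩ Iio (lcmTerm f g)) := by
    intro f hf g hg hf0 hg0 hc
    refine mem_multSpan_mono subset_rfl ?_ (hb (f, g) hf hg hf0 hg0 hc)
    refine fun v hv => ⟨?_, hv.1⟩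
    exact degreeLE_mono d ((hm₁ ⟨(f, g), ⟨hf, hg⟩, rfl⟩).trans (le_max_left _ _)) hv.2
  -- Induction on an upper bound `v` for the leading terms in a representation of `p`.
  have key : ∀ v ∈ degreeLE κ d m, ∀ p ∈ multSpan F (degreeLE κ d m ∩ Iic v), p ≠ 0 →
      IsReducible F (lt p) := by
    intro v hv
    refine (hd.wellFoundedOn m).induction hv
      (P := fun v => ∀ p ∈ multSpan F (degreeLE κ d m ∩ Iic v), p ≠ 0 → IsReducible F (lt p)) ?_
    intro v hv ih p hp hp0
    have ih' : p ∈ multSpan F (degreeLE κ d m ∩ Iio v) → IsReducible F (lt p) := by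
      intro hp'
      rcases multSpan_inter_Iic hp' with h | ⟨w, hw, h⟩
      · exact absurd h hp0
      · refine ih w hw.1 hw.2 p (mem_multSpan_mono subset_rfl ?_ h) hp0
        exact fun u hu => ⟨hu.1.1, hu.2⟩
    by_cases hex : ∃ f ∈ F, f ≠ 0 ∧ ∃ t : α, stimes t (lt f) = v
    · obtain ⟨f₀, hf₀, hf₀0, t₀, ht₀⟩ := hex
      -- Any multiple with leading term `v` is a scalar multiple of the fixed `shift t₀ f₀` plus a
      -- scaled, shifted S-polynomial. The latter is resolved, so modulo multiples strictly below
      -- `v` everything at `v` collapses to `c • shift t₀ f₀`.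
      have hdec : ∃ c : K, p - c • shift t₀ f₀ ∈ multSpan F (degreeLE κ d m ∩ Iio v) := by
        refine Submodule.span_induction ?_ ⟨0, by simp⟩ ?_ ?_ hp
        · rintro _ ⟨f, hf, hf0, t, ht, rfl⟩
          rcases (show stimes t (lt f) ≤ v from ht.2).lt_or_eq with hlt | heq
          · refine ⟨0, ?_⟩
            rw [zero_smul, sub_zero]
            exact shift_mem_multSpan hf hf0 ⟨ht.1, hlt⟩
          · refine ⟨lc f / lc f₀, ?_⟩
            obtain ⟨u, hu, hsp⟩ := exists_shift_spoly heq ht₀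
            have hc : (lt f).comp = (lt f₀).comp := by
              have := congrArg Term.comp (heq.trans ht₀.symm)
              simpa using this
            have hmem : shift u (spoly f f₀) ∈ multSpan F (degreeLE κ d m ∩ Iio v) := by
              refine shift_multSpan ?_ (hm f hf f₀ hf₀ hf0 hf₀0 hc)
              rintro w ⟨hw, hw'⟩
              refine ⟨?_, ?_⟩
              · change d (u * w.pp) ≤ m
                rw [hd.map_mul]
                -- The shift `u` divides `v`, which keeps the shifted representation in degree at
                -- most `m`.
                have hdvd : u ∣ v.pp := ⟨(lcmTerm f f₀).pp, by rw [← hu, stimes_pp]⟩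
                exact max_le ((hd.mono hdvd).trans hv) hw
              · rw [← hu]; exact stimes_strictMono u hw'
            have := Submodule.smul_mem _ (lc f) hmem
            rw [hsp, smul_sub, smul_smul, smul_smul, mul_one_div_cancel (lc_ne_zero hf0),
              one_smul, mul_one_div] at this
            exact this
        · rintro p q - - ⟨c, hc⟩ ⟨e, he⟩
          refine ⟨c + e, ?_⟩
          convert add_mem hc he using 1
          rw [add_smul]; abel
        · rintro e p - ⟨c, hc⟩
          refine ⟨e * c, ?_⟩
          convert Submodule.smul_mem _ e hc using 1
          rw [smul_sub, smul_smul]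
      obtain ⟨c, hc⟩ := hdec
      -- If `c = 0`, then `p` has a representation strictly below `v`. Otherwise `v` survives in `p`
      -- and is its leading term, a multiple of `lt f₀`.
      by_cases hc0 : c = 0
      · exact ih' (by simpa [hc0] using hc)
      · have hsupp := support_subset_of_mem_multSpan (isLowerSet_Iio v)
          (multSpan_mono subset_rfl inter_subset_right hc)
        have hpv : p v ≠ 0 := by
          have h0 : (p - c • shift t₀ f₀) v = 0 := by
            by_contra hne
            exact lt_irrefl v (hsupp (Finsupp.mem_support_iff.2 hne))
          rw [Finsupp.sub_apply, sub_eq_zero] at h0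
          rw [h0, Finsupp.smul_apply, ← ht₀, shift_apply_stimes]
          exact mul_ne_zero hc0 (lc_ne_zero hf₀0)
        have hle : (p.support : Set (Term α κ)) ⊆ Iic v :=
          (support_subset_of_mem_multSpan (S := Iic v) (isLowerSet_Iic v)
            (multSpan_mono subset_rfl inter_subset_right hp))
        refine ⟨f₀, hf₀, hf₀0, ?_⟩
        rw [lt_eq_of hpv fun w hw => hle hw, ← ht₀]
        exact Term.Dvd.stimes _ _
    · refine ih' (Submodule.span_mono ?_ hp)
      rintro _ ⟨f, hf, hf0, t, ht, rfl⟩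
      exact ⟨f, hf, hf0, t, ⟨ht.1, lt_of_le_of_ne ht.2 fun h => hex ⟨f, hf, hf0, t, h⟩⟩, rfl⟩
  have hp' : p ∈ multSpan F (degreeLE κ d m) := multSpan_mono subset_rfl
    (fun v hv => degreeLE_mono d (le_max_right _ _) hv.2) hm₂
  rcases multSpan_inter_Iic hp' with h | ⟨v, hv, h⟩
  · exact absurd h hp0
  · exact key v hv p h hp0

omit [LinearOrder α] [LinearOrder κ] [IsTermOrder α κ] [GradedDicksonPowerprod α] in
/-- If leading terms `e_i` occur for all components, then all terms in the submodule are
reducible. -/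
theorem isReducible_of_genWholeModule {bs : List (VPoly α κ K)} (h : GenWholeModule bs)
    {p : VPoly α κ K} (hp : p ∈ pmdl {b | b ∈ bs}) {v : Term α κ} (hv : v ∈ p.support) :
    IsReducible {b | b ∈ bs} v := by
  classical
  -- Multiplication by monomials preserves components, so only components occurring in `bs` can
  -- occur in `p`.
  have key : ∀ v ∈ p.support, ∃ b ∈ bs, ∃ w ∈ b.support, w.comp = v.comp := by
    clear hv
    induction hp with
    | zero => simp
    | base b hb => exact fun v hv => ⟨b, hb, v, hv, rfl⟩
    | add p q _ _ hp hq =>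
      intro v hv
      rcases Finset.mem_union.1 (Finsupp.support_add hv) with h | h
      exacts [hp v h, hq v h]
    | monomMult c t p _ hp =>
      intro v hv
      obtain ⟨w, hw, rfl⟩ := support_shift t p (Finsupp.support_smul hv)
      exact hp w hw
  obtain ⟨b, hb, w, hw, hwv⟩ := key v hv
  obtain ⟨b', hb', h0, hc, h1⟩ := h b hb w hw
  refine ⟨b', hb', h0, hc.trans hwv, ?_⟩
  change lp b' ∣ _
  rw [h1]
  exact one_dvd _

/-! ## Criteria for discarding pairs -/

/-- The chain criterion. -/
theorem isResolved_of_chain {F : Set (VPoly α κ K)} {p q r : VPoly α κ K} (hr0 : r ≠ 0)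
    (hr : (lt r).Dvd (lcmTerm p q)) (hpr : IsResolved F p r) (hrq : IsResolved F r q) :
    IsResolved F p q := by
  intro hp hq hc
  have h1 := hpr hp hr0 hr.1.symm
  have h2 := hrq hr0 hq (hr.1.trans hc)
  obtain ⟨s, t, hs, ht, e⟩ := spoly_eq hc
  obtain ⟨w, hw⟩ := hr.exists_stimes
  obtain ⟨u₁, hu₁, e₁⟩ := exists_shift_spoly hs hw
  obtain ⟨u₂, hu₂, e₂⟩ := exists_shift_spoly hw ht
  -- Inserting the monic multiple of `r` with leading term `lcmTerm p q` makes the difference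
  -- telescope; the shifts carry both bounds to `lcmTerm p q`.
  have : spoly p q = shift u₁ (spoly p r) + shift u₂ (spoly r q) := by
    rw [e, e₁, e₂]; abel
  rw [this]
  refine add_mem (shift_multSpan (fun v hv => ?_) h1) (shift_multSpan (fun v hv => ?_) h2)
  · rw [← hu₁]; exact stimes_strictMono u₁ hv
  · rw [← hu₂]; exact stimes_strictMono u₂ hv

omit [LinearOrder (Term α κ)] [LinearOrder α] [LinearOrder κ] [IsTermOrder α κ] [Nonempty κ]
  [GradedDicksonPowerprod α] in
-- With a single component, vector-polynomials are ordinary polynomials; both sides are their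
-- product.
theorem sum_shift_comm [Subsingleton κ] (p q : VPoly α κ K) :
    (p.sum fun v c => c • shift v.pp q) = q.sum fun v c => c • shift v.pp p := by
  have h : ∀ p q : VPoly α κ K, (p.sum fun v c => c • shift v.pp q) =
      p.sum fun v c => q.sum fun w e => Finsupp.single (stimes v.pp w) (c * e) := by
    intro p q
    refine Finsupp.sum_congr fun v _ => ?_
    conv_lhs => rw [← Finsupp.sum_single q]
    simp only [Finsupp.sum, map_sum, Finset.smul_sum, shift_single, Finsupp.smul_single,
      smul_eq_mul]
  rw [h, h, Finsupp.sum_comm]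
  refine Finsupp.sum_congr fun w _ => Finsupp.sum_congr fun v _ => ?_
  rw [mul_comm, show stimes v.pp w = stimes w.pp v from
    Term.ext (mul_comm _ _) (Subsingleton.elim _ _)]

omit [Field K] [Nonempty κ] [LinearOrder (Term α κ)] [LinearOrder α] [LinearOrder κ]
  [IsTermOrder α κ] in
-- By cancellation, the cofactor of the least common multiple in `s * t` divides both `s` and `t`;
-- hence it is a unit, that is `1`.
theorem lcm_eq_mul_of_isRelPrime {s t : α} (h : IsRelPrime s t) :
    GradedDicksonPowerprod.lcm s t = s * t := by
  obtain ⟨u, hu⟩ := GradedDicksonPowerprod.lcm_dvd s t (s * t) (Dvd.intro _ rfl)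
    (Dvd.intro_left _ rfl)
  obtain ⟨a, ha⟩ := GradedDicksonPowerprod.dvd_lcm s t
  obtain ⟨b, hb⟩ := GradedDicksonPowerprod.dvd_lcm t s
  rw [GradedDicksonPowerprod.lcm_comm] at hb
  have h1 : u ∣ t := ⟨a, mul_left_cancel (a := s) (by rw [hu, ha]; ac_rfl)⟩
  have h2 : u ∣ s := ⟨b, mul_left_cancel (a := t) (by rw [mul_comm, hu, hb]; ac_rfl)⟩
  obtain ⟨v, hv⟩ := (h h2 h1).exists_right_inv
  rw [hu, GradedDicksonPowerprod.mul_eq_one u v hv, mul_one]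

/-- The product criterion. -/
theorem isResolved_of_isRelPrime [Subsingleton κ] {F : Set (VPoly α κ K)} {p q : VPoly α κ K}
    (hpF : p ∈ F) (hqF : q ∈ F) (h : IsRelPrime (lp p) (lp q)) : IsResolved F p q := by
  intro hp hq hc
  -- The product of `g` and `f` minus the leading monomial of `g` times `f` is the tail of `g` times
  -- `f`, so only multiples of `f` below the least common multiple remain.
  have key : ∀ f ∈ F, f ≠ 0 → ∀ g : VPoly α κ K, g ≠ 0 → stimes (lt g).pp (lt f) = lcmTerm p q →
      (g.sum fun v c => c • shift v.pp f) - lc g • shift (lt g).pp f ∈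
        multSpan F (Iio (lcmTerm p q)) := by
    intro f hf hf0 g hg0 hfg
    classical
    rw [Finsupp.sum, ← Finset.add_sum_erase _ _ (lt_mem_support hg0)]
    rw [lc, add_sub_cancel_left]
    refine Submodule.sum_mem _ fun v hv => Submodule.smul_mem _ _ (shift_mem_multSpan hf hf0 ?_)
    rw [Finset.mem_erase] at hv
    rw [← hfg]
    have hlt : v < lt g := (le_lt hv.2).lt_of_ne hv.1
    have hsw : ∀ v w : Term α κ, stimes v.pp w = stimes w.pp v := fun v w =>
      Term.ext (mul_comm _ _) (Subsingleton.elim _ _)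
    rw [mem_Iio, hsw v, hsw (lt g)]
    exact stimes_strictMono _ hlt
  have hl : lcmTerm p q = stimes (lt q).pp (lt p) := by
    refine Term.ext ?_ rfl
    change GradedDicksonPowerprod.lcm (lp p) (lp q) = lp q * lp p
    rw [lcm_eq_mul_of_isRelPrime h, mul_comm]
  have hl' : lcmTerm p q = stimes (lt p).pp (lt q) := by
    rw [hl]; exact Term.ext (mul_comm _ _) (Subsingleton.elim _ _)
  have h1 := key p hpF hp q hq hl.symm
  have h2 := key q hqF hq p hp hl'.symm
  rw [sum_shift_comm] at h1
  -- The common product of `p` and `q` drops out of `h2 - h1`; dividing by both leading coefficients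
  -- leaves the S-polynomial.
  have h3 := Submodule.smul_mem _ ((lc p)⁻¹ * (lc q)⁻¹) (sub_mem h2 h1)
  obtain ⟨u, hu, e⟩ := exists_shift_spoly hl.symm hl'.symm
  have hu1 : u = 1 := mul_right_cancel (b := (lcmTerm p q).pp)
    (by rw [one_mul]; exact congrArg Term.pp hu)
  rw [hu1, shift_one] at e
  rw [e]
  convert h3 using 1
  have hcp := lc_ne_zero hp
  have hcq := lc_ne_zero hq
  rw [sub_sub_sub_cancel_left, smul_sub, smul_smul, smul_smul]
  congr 2 <;> field_simp

theorem IsDiscardable.isResolved {bs : List (VPoly α κ K)} {p q : VPoly α κ K} (hp : p ∈ bs)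
    (hq : q ∈ bs) (h : IsDiscardable bs p q) : IsResolved {b | b ∈ bs} p q := by
  rcases h with h | ⟨_, h⟩ | ⟨r, -, hr0, hr, h1, h2⟩
  · exact isResolved_of_redStar h
  · exact isResolved_of_isRelPrime hp hq h
  · exact isResolved_of_chain hr0 hr (isResolved_of_redStar h1) (isResolved_of_redStar h2)

end Groebner

/-! ## Macaulay matrices -/

section Macaulay

variable {α κ K : Type*} [Field K] [LinearOrder (Term α κ)]

theorem mem_keysToList {fs : List (VPoly α κ K)} {v : Term α κ} :
    v ∈ keysToList fs ↔ ∃ f ∈ fs, v ∈ f.support := by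
  rw [keysToList, Finset.mem_sort]
  induction fs with
  | nil => simp
  | cons f fs ih => rw [List.foldr_cons, Finset.mem_union, ih]; simp

theorem keysToList_get_strictAnti (fs : List (VPoly α κ K)) : StrictAnti (keysToList fs).get := by
  intro i j hij
  exact List.pairwise_iff_get.1 (Finset.sortedGT_sort _ |>.pairwise) i j hij

/-- The polynomial whose coefficients at the terms `vs` are given by a row vector. -/
noncomputable def rowPoly (vs : List (Term α κ)) : (Fin vs.length → K) →ₗ[K] VPoly α κ K where
  toFun r := ∑ j, Finsupp.single (vs.get j) (r j)
  map_add' r s := by simp [Finset.sum_add_distrib]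
  map_smul' c r := by simp [Finset.smul_sum]

omit [LinearOrder (Term α κ)] in
theorem mem_matToPolys {m : ℕ} {vs : List (Term α κ)} {A : Matrix (Fin m) (Fin vs.length) K}
    {g : VPoly α κ K} : g ∈ matToPolys vs A ↔ ∃ i, rowPoly vs (A i) = g := by
  rw [matToPolys, List.mem_ofFn]
  rfl

omit [LinearOrder (Term α κ)] in
theorem rowPoly_get {vs : List (Term α κ)} (hvs : Function.Injective vs.get)
    (r : Fin vs.length → K) (j : Fin vs.length) : rowPoly vs r (vs.get j) = r j := by
  classical
  change (∑ j, Finsupp.single (vs.get j) (r j)) (vs.get j) = r j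
  rw [Finsupp.finsetSum_apply, Finset.sum_eq_single j]
  · simp
  · intro i _ hij
    rw [Finsupp.single_apply, if_neg (fun h => hij (hvs h))]
  · simp

omit [LinearOrder (Term α κ)] in
theorem rowPoly_apply_of_notMem {vs : List (Term α κ)} (r : Fin vs.length → K) {v : Term α κ}
    (hv : v ∉ vs) : rowPoly vs r v = 0 := by
  classical
  change (∑ j, Finsupp.single (vs.get j) (r j)) v = 0
  rw [Finsupp.finsetSum_apply]
  refine Finset.sum_eq_zero fun i _ => ?_
  rw [Finsupp.single_apply, if_neg]
  rintro rfl
  exact hv (List.get_mem _ _)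

omit [LinearOrder (Term α κ)] in
theorem rowPoly_coeffs {vs : List (Term α κ)} (hvs : Function.Injective vs.get)
    {p : VPoly α κ K} (hp : ∀ v ∈ p.support, v ∈ vs) : rowPoly vs (fun j => p (vs.get j)) = p := by
  ext v
  by_cases hv : v ∈ vs
  · obtain ⟨j, rfl⟩ := List.get_of_mem hv
    rw [rowPoly_get hvs]
  · rw [rowPoly_apply_of_notMem _ hv]
    by_contra h
    exact hv (hp v (Finsupp.mem_support_iff.2 (Ne.symm h)))

/-- The columns are in descending order of terms, so the first non-zero entry of a row sits at the
leading term. -/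
theorem lt_rowPoly [CancelCommMonoid α] [Nonempty κ] {vs : List (Term α κ)}
    (hvs : StrictAnti vs.get)
    {r : Fin vs.length → K} {j : Fin vs.length} (hj : r j ≠ 0) (h : ∀ i < j, r i = 0) :
    lt (rowPoly vs r) = vs.get j := by
  refine lt_eq_of (by rwa [rowPoly_get hvs.injective]) fun w hw => ?_
  rw [Finsupp.mem_support_iff] at hw
  by_cases hv : w ∈ vs
  · obtain ⟨i, rfl⟩ := List.get_of_mem hv
    rw [rowPoly_get hvs.injective] at hw
    exact hvs.antitone (not_lt.1 fun hij => hw (h i hij))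
  · exact absurd (rowPoly_apply_of_notMem _ hv) hw

omit [LinearOrder (Term α κ)] in
-- Take the first non-zero row with non-zero coefficient in the combination. Its pivot column
-- vanishes in all other rows, so the pivot survives; to the left of the pivot, this row and all
-- later ones are zero by the staircase shape.
theorem exists_isLeadingEntry_vecMul {m n : ℕ} {B : Matrix (Fin m) (Fin n) K}
    (hB : B.IsReducedRowEchelon) {y : Fin m → K} (hy : Matrix.vecMul y B ≠ 0) :
    ∃ i j, B.IsLeadingEntry i j ∧ Matrix.vecMul y B j ≠ 0 ∧ ∀ j' < j, Matrix.vecMul y B j' = 0 := by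
  classical
  have happ : ∀ j, Matrix.vecMul y B j = ∑ k, y k * B k j := fun j => rfl
  have hne : (Finset.univ.filter fun i => y i ≠ 0 ∧ B i ≠ 0).Nonempty := by
    by_contra hemp
    apply hy
    funext j
    rw [happ]
    refine Finset.sum_eq_zero fun k _ => ?_
    by_contra hk
    refine hemp ⟨k, Finset.mem_filter.2 ⟨Finset.mem_univ _, left_ne_zero_of_mul hk, fun h => ?_⟩⟩
    exact right_ne_zero_of_mul hk (congrFun h j)
  have hmin := Finset.min'_mem _ hne
  have hle := fun k hk => Finset.min'_le (Finset.univ.filter fun i => y i ≠ 0 ∧ B i ≠ 0) k hk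
  set i := Finset.min' _ hne
  simp only [Finset.mem_filter, Finset.mem_univ, true_and] at hmin hle
  obtain ⟨j, hj⟩ := (Matrix.row_ne_zero_iff_exists_isLeadingEntry).1 hmin.2
  refine ⟨i, j, hj, ?_, fun j' hj' => ?_⟩
  · rw [happ, Finset.sum_eq_single i]
    · exact mul_ne_zero hmin.1 hj.2
    · intro k _ hk
      rw [hB.eq_zero_of_ne_of_isLeadingEntry hk hj, mul_zero]
    · simp
  · rw [happ]
    refine Finset.sum_eq_zero fun k _ => ?_
    by_cases hk : y k ≠ 0 ∧ B k ≠ 0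
    · rcases (hle k hk).eq_or_lt with h | h
      · rw [← h, hj.1 j' hj', mul_zero]
      · rw [hB.1 h fun j'' h'' => hj.1 j'' (h''.trans hj'), mul_zero]
    · rw [not_and_or, not_not, not_not] at hk
      rcases hk with h | h <;> simp [h]

theorem rowPoly_macaulayMat (fs : List (VPoly α κ K)) (i : Fin fs.length) :
    rowPoly (keysToList fs) (macaulayMat fs i) = fs.get i :=
  rowPoly_coeffs (keysToList_get_strictAnti fs).injective fun _ hv =>
    mem_keysToList.2 ⟨_, List.get_mem _ _, hv⟩

/-- The polynomials in the reduced row echelon form of the Macaulay matrix are linear combinations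
of the given ones. -/
theorem mem_span_of_mem_matToPolys {fs : List (VPoly α κ K)} {g : VPoly α κ K}
    (hg : g ∈ matToPolys (keysToList fs) (rowEchelon (macaulayMat fs))) :
    g ∈ Submodule.span K {f | f ∈ fs} := by
  obtain ⟨i, rfl⟩ := mem_matToPolys.1 hg
  obtain ⟨-, P, -, hP⟩ := (exists_reducedRowEchelon (macaulayMat fs)).choose_spec
  have : rowEchelon (macaulayMat fs) i = ∑ k, P i k • macaulayMat fs k := by
    funext j
    rw [rowEchelon, hP, Matrix.mul_apply, Finset.sum_apply]
    rfl
  rw [this, map_sum]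
  refine Submodule.sum_mem _ fun k _ => ?_
  rw [map_smul, rowPoly_macaulayMat]
  exact Submodule.smul_mem _ _ (Submodule.subset_span (List.get_mem _ _))

/-- The leading terms of linear combinations of polynomials are among the leading terms in the
reduced row echelon form of their Macaulay matrix. -/
theorem exists_mem_matToPolys_lt_eq [CancelCommMonoid α] [Nonempty κ]
    {fs : List (VPoly α κ K)} {h : VPoly α κ K}
    (hh : h ∈ Submodule.span K {f | f ∈ fs}) (h0 : h ≠ 0) :
    ∃ g ∈ matToPolys (keysToList fs) (rowEchelon (macaulayMat fs)), g ≠ 0 ∧ lt g = lt h := by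
  obtain ⟨hB, P, ⟨P, rfl⟩, hP⟩ := (exists_reducedRowEchelon (macaulayMat fs)).choose_spec
  change (rowEchelon (macaulayMat fs)).IsReducedRowEchelon at hB
  change rowEchelon (macaulayMat fs) = _ at hP
  set B := rowEchelon (macaulayMat fs)
  -- Inverting the row operations expresses the original rows, and hence the whole span of `fs`,
  -- through rows of the echelon form.
  have hA : macaulayMat fs = (↑P⁻¹ : Matrix (Fin fs.length) (Fin fs.length) K) * B := by
    rw [hP, ← Matrix.mul_assoc, ← Units.val_mul, inv_mul_cancel, Units.val_one, Matrix.one_mul]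
  have hle : Submodule.span K {f | f ∈ fs} ≤
      LinearMap.range ((rowPoly (K := K) (keysToList fs)).comp (Matrix.vecMulLinear B)) := by
    refine Submodule.span_le.2 fun f hf => ?_
    obtain ⟨i, rfl⟩ := List.get_of_mem hf
    refine ⟨(↑P⁻¹ : Matrix (Fin fs.length) (Fin fs.length) K) i, ?_⟩
    rw [← rowPoly_macaulayMat, hA]
    rfl
  obtain ⟨y, rfl⟩ := hle hh
  have hy : Matrix.vecMul y B ≠ 0 := by
    intro hy
    apply h0
    change rowPoly _ (Matrix.vecMul y B) = 0
    rw [hy, map_zero]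
  have hvs := keysToList_get_strictAnti fs
  obtain ⟨i, j, hj, hyj, hyj'⟩ := exists_isLeadingEntry_vecMul hB hy
  refine ⟨_, mem_matToPolys.2 ⟨i, rfl⟩, fun h => hj.2 ?_, ?_⟩
  · rw [← rowPoly_get hvs.injective (B i) j, h]; rfl
  · exact (lt_rowPoly hvs hj.2 hj.1).trans (lt_rowPoly hvs hyj hyj').symm

variable [CancelCommMonoid α] [Nonempty κ]

theorem mem_macaulayRed {fs : List (VPoly α κ K)} {g : VPoly α κ K} :
    g ∈ macaulayRed fs ↔ g ∈ matToPolys (keysToList fs) (rowEchelon (macaulayMat fs)) ∧ g ≠ 0 ∧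
      ∀ f ∈ fs, f ≠ 0 → lt f ≠ lt g := by
  simp [macaulayRed]

theorem macaulayRed_mem_span {fs : List (VPoly α κ K)} {g : VPoly α κ K}
    (hg : g ∈ macaulayRed fs) : g ∈ Submodule.span K {f | f ∈ fs} :=
  mem_span_of_mem_matToPolys (mem_macaulayRed.1 hg).1

omit [LinearOrder (Term α κ)] [CancelCommMonoid α] [Nonempty κ] in
theorem support_subset_of_mem_span {F : Set (VPoly α κ K)} {S : Set (Term α κ)}
    (hF : ∀ f ∈ F, (f.support : Set (Term α κ)) ⊆ S) {g : VPoly α κ K}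
    (hg : g ∈ Submodule.span K F) : (g.support : Set (Term α κ)) ⊆ S :=
  (Submodule.span_le.2 hF : Submodule.span K F ≤ Finsupp.supported K K S) hg

variable [LinearOrder α] [LinearOrder κ] [IsTermOrder α κ]

/-- If all `fs` are multiples of elements of `bs`, then their linear combinations reduce to `0`
modulo `bs` and the new polynomials in the reduced row echelon form. -/
theorem redStar_zero_of_mem_span {bs fs : List (VPoly α κ K)}
    (hfs : ∀ f ∈ fs, ∃ b ∈ bs, ∃ (c : K) (t : α), f = c • shift t b) {h : VPoly α κ K}
    (hh : h ∈ Submodule.span K {f | f ∈ fs}) : RedStar {b | b ∈ bs ++ macaulayRed fs} h 0 := by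
  -- The span is supported on the finitely many columns, so induction on the leading term needs no
  -- degree bound here.
  set T : Set (Term α κ) := {v | v ∈ keysToList fs}
  have hT : T.Finite := List.finite_toSet _
  have hsupp : ∀ g ∈ Submodule.span K {f | f ∈ fs}, (g.support : Set (Term α κ)) ⊆ T :=
    fun g hg => support_subset_of_mem_span
      (fun f hf v hv => mem_keysToList.2 ⟨f, hf, hv⟩) hg
  have key : ∀ v ∈ T, ∀ h ∈ Submodule.span K {f | f ∈ fs}, h ≠ 0 → lt h = v →
      RedStar {b | b ∈ bs ++ macaulayRed fs} h 0 := by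
    intro v hv
    refine (hT.wellFoundedOn (r := (· < ·))).induction hv
      (P := fun v => ∀ h ∈ Submodule.span K {f | f ∈ fs}, h ≠ 0 → lt h = v →
        RedStar {b | b ∈ bs ++ macaulayRed fs} h 0) ?_
    rintro _ hv ih h hh h0 rfl
    -- A reducer for the leading term of `h` whose subtracted multiple lies in the span. The clause
    -- ranges over all `t` because `exists_red` supplies its own cofactor, which cancellation shows
    -- to be the intended one.
    obtain ⟨f, hf, hf0, hdvd, hspan⟩ : ∃ f ∈ {b | b ∈ bs ++ macaulayRed fs}, f ≠ 0 ∧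
        (lt f).Dvd (lt h) ∧ ∀ t : α, stimes t (lt f) = lt h →
          shift t f ∈ Submodule.span K {f | f ∈ fs} := by
      have cancel : ∀ {a b : α} {w : Term α κ}, stimes a w = stimes b w → a = b := fun h =>
        mul_right_cancel (congrArg Term.pp h)
      obtain ⟨g, hg, hg0, hgh⟩ := exists_mem_matToPolys_lt_eq hh h0
      -- Either the row is a new polynomial and reduces `h` with cofactor `1`, or its leading term
      -- is that of some `c • shift t b` in `fs`, and `b` is the reducer.
      by_cases hnew : ∀ f ∈ fs, f ≠ 0 → lt f ≠ lt g
      · have hgr := mem_macaulayRed.2 ⟨hg, hg0, hnew⟩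
        refine ⟨g, List.mem_append_right _ hgr, hg0, hgh ▸ ⟨rfl, dvd_rfl⟩, fun t ht => ?_⟩
        · have : t = 1 := cancel (w := lt g) (by rw [ht, stimes_one, hgh])
          rw [this, shift_one]
          exact macaulayRed_mem_span hgr
      · push Not at hnew
        obtain ⟨f, hf, hf0, hfg⟩ := hnew
        obtain ⟨b, hb, c, t, rfl⟩ := hfs f hf
        have hc : c ≠ 0 := by rintro rfl; simp at hf0
        have hb0 : b ≠ 0 := by rintro rfl; simp at hf0
        have hlt : stimes t (lt b) = lt h := by
          rw [← lt_shift t hb0, ← hgh, ← hfg, lt_smul hc]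
        refine ⟨b, List.mem_append_left _ hb, hb0, hlt ▸ Term.Dvd.stimes _ _, fun s hs => ?_⟩
        rw [cancel (hs.trans hlt.symm)]
        have := Submodule.smul_mem (Submodule.span K {f | f ∈ fs}) c⁻¹ (Submodule.subset_span hf)
        rwa [smul_smul, inv_mul_cancel₀ hc, one_smul] at this
    obtain ⟨c, t, ht, hred, hz, habove⟩ := exists_red hf hf0 hdvd (lt_mem_support h0)
    have hmem := sub_mem hh (Submodule.smul_mem _ c (hspan t ht))
    refine Relation.ReflTransGen.head hred ?_
    by_cases h0' : h - c • shift t f = 0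
    · rw [h0']
    · refine ih _ (hsupp _ hmem (lt_mem_support h0')) ?_ _ hmem h0' rfl
      have hl := lc_ne_zero h0'
      rw [lc] at hl
      by_contra hlt
      rcases (not_lt.1 hlt).eq_or_lt with e | e
      · exact hl (e ▸ hz)
      · rw [habove _ e] at hl
        exact hlt.elim ((le_lt (Finsupp.mem_support_iff.2 hl)).lt_of_ne e.ne')
  by_cases h0 : h = 0
  · rw [h0]; exact Relation.ReflTransGen.refl
  · exact key _ (hsupp h hh (lt_mem_support h0)) h hh h0 rfl

end Macaulay

/-! ## Loops -/

/-- The invariant rule for loops: `Nat.find` picks the first stopping index, so the condition holds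
at every earlier state and `hI` applies there. -/
theorem exists_whileOption_eq_some {σ : Type*} {c : σ → Prop} {f : σ → σ} {s : σ} (I : σ → Prop)
    (h0 : I s) (hI : ∀ s, I s → c s → I (f s)) (hterm : ∃ n : ℕ, ¬ c (f^[n] s)) :
    ∃ r, whileOption c f s = some r ∧ I r ∧ ¬ c r := by
  classical
  refine ⟨_, dif_pos hterm, ?_, ?_⟩
  · have : ∀ n ≤ Nat.find hterm, I (f^[n] s) := by
      intro n
      induction n with
      | zero => exact fun _ => h0
      | succ n ih =>
        intro hn
        rw [Function.iterate_succ_apply']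
        exact hI _ (ih (by omega)) (not_not.1 (Nat.find_min hterm (by omega)))
    convert this _ le_rfl
  · convert Nat.find_spec hterm

/-! ## Symbolic preprocessing -/

section SymPreproc

variable {α κ K : Type*} [CancelCommMonoid α] [Field K] [Nonempty κ] [LinearOrder (Term α κ)]

theorem mem_symPreprocAddnew_fst {bs fs : List (VPoly α κ K)} {vs : List (Term α κ)}
    {v w : Term α κ} : w ∈ (symPreprocAddnew bs vs fs v).1 ↔
      w ∈ vs ∨ ∃ b ∈ bs, (b ≠ 0 ∧ (lt b).Dvd v) ∧
        w ∈ (tail (shift (ppDiv v.pp (lp b)) b)).support := by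
  induction bs generalizing vs fs with
  | nil => simp [symPreprocAddnew]
  | cons b bs ih =>
    rw [symPreprocAddnew]
    by_cases h : b ≠ 0 ∧ (lt b).Dvd v
    · rw [if_pos h]
      simp only [ih, List.mem_append, mem_keysToList, monomMult_eq, one_smul, List.mem_cons,
        List.not_mem_nil, false_and, exists_false, false_or, exists_eq_or_imp, eq_true h,
        true_and, or_assoc]
    · rw [if_neg h]
      simp only [ih, List.mem_cons, exists_eq_or_imp, eq_false h, false_and, false_or]

/-- The test `f ∈ fs` only avoids repetitions, so it disappears at the level of membership, which is
all that the correctness argument uses. -/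
theorem mem_symPreprocAddnew_snd {bs fs : List (VPoly α κ K)} {vs : List (Term α κ)}
    {v : Term α κ} {f : VPoly α κ K} : f ∈ (symPreprocAddnew bs vs fs v).2 ↔
      f ∈ fs ∨ ∃ b ∈ bs, (b ≠ 0 ∧ (lt b).Dvd v) ∧ f = shift (ppDiv v.pp (lp b)) b := by
  induction bs generalizing vs fs with
  | nil => simp [symPreprocAddnew]
  | cons b bs ih =>
    rw [symPreprocAddnew]
    by_cases h : b ≠ 0 ∧ (lt b).Dvd v
    · rw [if_pos h]
      have e : monomMult 1 (ppDiv v.pp (lp b)) b = shift (ppDiv v.pp (lp b)) b := one_smul _ _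
      simp only [ih, List.mem_cons, exists_eq_or_imp, eq_true h, true_and, e]
      rw [← or_assoc]
      refine or_congr ?_ Iff.rfl
      split_ifs with h'
      · exact ⟨Or.inl, fun h => h.elim id fun h => h ▸ e ▸ h'⟩
      · rw [List.mem_cons, or_comm]
    · rw [if_neg h]
      simp only [ih, List.mem_cons, exists_eq_or_imp, eq_false h, false_and, false_or]

theorem mem_support_tail {p : VPoly α κ K} {w : Term α κ} :
    w ∈ (tail p).support ↔ w ≠ lt p ∧ w ∈ p.support := by
  classical
  rw [tail, Finsupp.support_erase, Finset.mem_erase]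

/-- The terms of bounded degree whose components lie in a given set. -/
def termBox (d : α → ℕ) (m : ℕ) (C : Set κ) : Set (Term α κ) := degreeLE κ d m ∩ {v | v.comp ∈ C}

omit [Nonempty κ] [LinearOrder (Term α κ)] in
-- Boxes are closed under multiplication by power-products of degree at most `m`, because the degree
-- of a product is a maximum rather than a sum.
theorem support_shift_subset_termBox {d : α → ℕ} (hd : IsDicksonGrading d) {m : ℕ} {C : Set κ}
    {t : α} (ht : d t ≤ m) {p : VPoly α κ K} (hp : (p.support : Set _) ⊆ termBox d m C) :
    ((shift t p).support : Set _) ⊆ termBox d m C := by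
  intro w hw
  obtain ⟨v, hv, rfl⟩ := support_shift t p hw
  refine ⟨?_, (hp hv).2⟩
  change d (t * v.pp) ≤ m
  rw [hd.map_mul]
  exact max_le ht (hp hv).1

omit [Nonempty κ] [LinearOrder (Term α κ)] in
theorem degree_ppDiv_le {d : α → ℕ} (hd : IsDicksonGrading d) {m : ℕ} {s t : α} (h : s ∣ t)
    (ht : d t ≤ m) : d (ppDiv t s) ≤ m :=
  (hd.mono ⟨s, (ppDiv_mul h).symm⟩).trans ht

/-- One iteration up to membership. All copies of the maximal term are removed, as the strict
descent in the termination proof requires. -/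
theorem symPreprocStep_eq {bs : List (VPoly α κ K)} {s : List (Term α κ) × List (VPoly α κ K)}
    (hs : s.1 ≠ []) : ∃ v ∈ s.1, (∀ u ∈ s.1, u ≤ v) ∧
      (∀ w, w ∈ (symPreprocStep bs s).1 ↔ (w ∈ s.1 ∧ w ≠ v) ∨ ∃ b ∈ bs, (b ≠ 0 ∧ (lt b).Dvd v) ∧
        w ∈ (tail (shift (ppDiv v.pp (lp b)) b)).support) ∧
      ∀ f, f ∈ (symPreprocStep bs s).2 ↔
        f ∈ s.2 ∨ ∃ b ∈ bs, (b ≠ 0 ∧ (lt b).Dvd v) ∧ f = shift (ppDiv v.pp (lp b)) b := by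
  obtain ⟨v, hv⟩ := Option.ne_none_iff_exists'.1 (mt List.max?_eq_none_iff.1 hs)
  have hv' := List.max?_eq_some_iff.1 hv
  refine ⟨v, hv'.1, hv'.2, ?_, ?_⟩
  · intro w
    simp only [symPreprocStep, hv, mem_symPreprocAddnew_fst]
    simp
  · intro f
    simp only [symPreprocStep, hv, mem_symPreprocAddnew_snd]

variable [LinearOrder α] [LinearOrder κ] [IsTermOrder α κ]

theorem lt_shift_ppDiv {b : VPoly α κ K} {v : Term α κ} (hb : b ≠ 0) (h : (lt b).Dvd v) :
    lt (shift (ppDiv v.pp (lp b)) b) = v := by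
  rw [lt_shift _ hb]
  exact stimes_ppDiv h

variable [GradedDicksonPowerprod α]

omit [LinearOrder α] [LinearOrder κ] [IsTermOrder α κ] in
theorem support_subset_of_mem_pairsToList {d : α → ℕ} (hd : IsDicksonGrading d) {m : ℕ} {C : Set κ}
    {sps : List (VPoly α κ K × VPoly α κ K)}
    (hsps : ∀ x ∈ sps, (x.1.support : Set _) ⊆ termBox d m C ∧
      (x.2.support : Set _) ⊆ termBox d m C)
    {f : VPoly α κ K} (hf : f ∈ pairsToList sps) : (f.support : Set _) ⊆ termBox d m C := by
  have key : ∀ p q r : VPoly α κ K, (p.support : Set _) ⊆ termBox d m C →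
      (q.support : Set _) ⊆ termBox d m C → (r = p ∨ r = q) →
      ((shift (ppDiv (GradedDicksonPowerprod.lcm (lp p) (lp q)) (lp r)) r).support : Set _) ⊆
        termBox d m C := by
    intro p q r hp hq hr
    by_cases hr0 : r = 0
    · simp [hr0]
    have hrs : (r.support : Set _) ⊆ termBox d m C := by rcases hr with rfl | rfl <;> assumption
    -- Needed because the other member of the pair may be `0`, whose dummy leading power-product is
    -- `1`.
    have h1 : d 1 ≤ m := (hd.mono (one_dvd _)).trans (hrs (lt_mem_support hr0)).1
    have hdeg : ∀ p : VPoly α κ K, (p.support : Set _) ⊆ termBox d m C → d (lp p) ≤ m := by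
      intro p hp
      by_cases hp0 : p = 0
      · simpa [hp0, lp, lt] using h1
      · exact (hp (lt_mem_support hp0)).1
    refine support_shift_subset_termBox hd (degree_ppDiv_le hd ?_ ?_) hrs
    · rcases hr with rfl | rfl
      · exact GradedDicksonPowerprod.dvd_lcm _ _
      · rw [GradedDicksonPowerprod.lcm_comm]; exact GradedDicksonPowerprod.dvd_lcm _ _
    -- The least common multiple divides the product, whose degree is the larger of the two degrees.
    · refine (hd.mono (GradedDicksonPowerprod.lcm_dvd (lp p) (lp q) (lp p * lp q)
        (Dvd.intro _ rfl) (Dvd.intro_left _ rfl))).trans ?_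
      rw [hd.map_mul]
      exact max_le (hdeg p hp) (hdeg q hq)
  rw [pairsToList, List.mem_flatMap] at hf
  obtain ⟨x, hx, hf⟩ := hf
  obtain ⟨h1, h2⟩ := hsps x hx
  simp only [List.mem_cons, List.not_mem_nil, or_false, monomMult_eq] at hf
  intro v hv
  rcases hf with rfl | rfl
  · exact key x.1 x.2 x.1 h1 h2 (Or.inl rfl) (Finsupp.support_smul hv)
  · exact key x.1 x.2 x.2 h1 h2 (Or.inr rfl) (Finsupp.support_smul hv)

/-- Symbolic preprocessing terminates. Its result consists of the multiples belonging to the given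
pairs and of multiples of basis elements, and every term in it that is divisible by the leading
term of a basis element is the leading term of an element of the result. -/
theorem exists_symPreproc_eq_some [WellFoundedLT κ] {d : α → ℕ} (hd : IsDicksonGrading d) {m : ℕ}
    {C : Set κ}
    {bs : List (VPoly α κ K)} {sps : List (VPoly α κ K × VPoly α κ K)}
    (hbs : ∀ b ∈ bs, (b.support : Set _) ⊆ termBox d m C)
    (hsps : ∀ x ∈ sps, (x.1.support : Set _) ⊆ termBox d m C ∧
      (x.2.support : Set _) ⊆ termBox d m C) :
    ∃ fs, symPreproc bs sps = some fs ∧ (∀ f ∈ pairsToList sps, f ∈ fs) ∧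
      (∀ f ∈ fs, f ∈ pairsToList sps ∨ ∃ b ∈ bs, ∃ t : α, f = shift t b) ∧
      (∀ f ∈ fs, (f.support : Set _) ⊆ termBox d m C) ∧
      ∀ f ∈ fs, ∀ w ∈ f.support, ∀ b ∈ bs, b ≠ 0 → (lt b).Dvd w →
        ∃ g ∈ fs, g ≠ 0 ∧ lt g = w := by
  have hstep : ∀ b ∈ bs, ∀ v ∈ termBox d m C, (lt b).Dvd v →
      ((shift (ppDiv v.pp (lp b)) b).support : Set _) ⊆ termBox d m C := by
    intro b hb v hv h
    exact support_shift_subset_termBox hd (degree_ppDiv_le hd h.2 hv.1) (hbs b hb)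
  -- Induction on an upper bound for the worklist: one iteration replaces its maximum by smaller
  -- terms inside the same box, so the maximum strictly drops.
  have hterm : ∀ v ∈ degreeLE κ d m, ∀ s : List (Term α κ) × List (VPoly α κ K),
      (∀ w ∈ s.1, w ∈ termBox d m C) → (∀ w ∈ s.1, w ≤ v) →
      ∃ n : ℕ, ((symPreprocStep bs)^[n] s).1 = [] := by
    intro v hv
    refine (hd.wellFoundedOn m).induction hv
      (P := fun v => ∀ s : List (Term α κ) × List (VPoly α κ K),
        (∀ w ∈ s.1, w ∈ termBox d m C) → (∀ w ∈ s.1, w ≤ v) →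
        ∃ n : ℕ, ((symPreprocStep bs)^[n] s).1 = []) ?_
    intro v hv ih s hs hsv
    by_cases h0 : s.1 = []
    · exact ⟨0, h0⟩
    obtain ⟨u, hu, hmax, h1, -⟩ := symPreprocStep_eq (bs := bs) h0
    have hlt : ∀ w ∈ (symPreprocStep bs s).1, w < u := by
      intro w hw
      rcases (h1 w).1 hw with ⟨hw, hne⟩ | ⟨b, hb, ⟨hb0, hbu⟩, hw⟩
      · exact (hmax w hw).lt_of_ne hne
      · rw [mem_support_tail, lt_shift_ppDiv hb0 hbu] at hw
        have := le_lt hw.2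
        rw [lt_shift_ppDiv hb0 hbu] at this
        exact this.lt_of_ne hw.1
    have hbox : ∀ w ∈ (symPreprocStep bs s).1, w ∈ termBox d m C := by
      intro w hw
      rcases (h1 w).1 hw with ⟨hw, -⟩ | ⟨b, hb, ⟨-, hbu⟩, hw⟩
      · exact hs w hw
      · exact hstep b hb u (hs u hu) hbu (mem_support_tail.1 hw).2
    by_cases h0' : (symPreprocStep bs s).1 = []
    · exact ⟨1, h0'⟩
    · obtain ⟨u', hu', hmax', -⟩ := symPreprocStep_eq (bs := bs) h0'
      obtain ⟨n, hn⟩ := ih u' (hbox u' hu').1 ((hlt u' hu').trans_le (hsv u hu)) _ hbox hmax'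
      exact ⟨n + 1, by rwa [Function.iterate_succ_apply]⟩
  have hpairs := fun f hf => support_subset_of_mem_pairsToList hd hsps (f := f) hf
  -- The essential invariant is the last clause: each term of the collected polynomials either still
  -- waits in the worklist or, if divisible by a leading term of `bs`, is already a leading term in
  -- the collection.
  refine Exists.elim (exists_whileOption_eq_some
    (c := fun s => s.1 ≠ []) (f := symPreprocStep bs)
    (s := (keysToList (pairsToList sps), pairsToList sps))
    (fun s => (∀ f ∈ pairsToList sps, f ∈ s.2) ∧
      (∀ f ∈ s.2, f ∈ pairsToList sps ∨ ∃ b ∈ bs, ∃ t : α, f = shift t b) ∧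
      ((∀ w ∈ s.1, w ∈ termBox d m C) ∧ ∀ f ∈ s.2, (f.support : Set _) ⊆ termBox d m C) ∧
      ∀ f ∈ s.2, ∀ w ∈ f.support, w ∈ s.1 ∨ ∀ b ∈ bs, b ≠ 0 → (lt b).Dvd w →
        ∃ g ∈ s.2, g ≠ 0 ∧ lt g = w) ?_ ?_ ?_) ?_
  · refine ⟨fun _ h => h, fun _ h => Or.inl h, ⟨fun w hw => ?_, hpairs⟩, fun f hf w hw => ?_⟩
    · obtain ⟨f, hf, hw⟩ := mem_keysToList.1 hw
      exact hpairs f hf hw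
    · exact Or.inl (mem_keysToList.2 ⟨f, hf, hw⟩)
  · rintro s ⟨h1, h2, ⟨h3, h3'⟩, h4⟩ hs
    obtain ⟨v, hv, -, e1, e2⟩ := symPreprocStep_eq (bs := bs) hs
    have hnew : ∀ b ∈ bs, b ≠ 0 → (lt b).Dvd v →
        ∃ g ∈ (symPreprocStep bs s).2, g ≠ 0 ∧ lt g = v := fun b hb hb0 hbv =>
      ⟨_, (e2 _).2 (Or.inr ⟨b, hb, ⟨hb0, hbv⟩, rfl⟩), shift_ne_zero _ hb0, lt_shift_ppDiv hb0 hbv⟩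
    refine ⟨fun f hf => (e2 f).2 (Or.inl (h1 f hf)), fun f hf => ?_,
      ⟨fun w hw => ?_, fun f hf => ?_⟩, fun f hf w hw => ?_⟩
    · rcases (e2 f).1 hf with hf | ⟨b, hb, -, rfl⟩
      exacts [h2 f hf, Or.inr ⟨b, hb, _, rfl⟩]
    · rcases (e1 w).1 hw with ⟨hw, -⟩ | ⟨b, hb, ⟨-, hbv⟩, hw⟩
      exacts [h3 w hw, hstep b hb v (h3 v hv) hbv (mem_support_tail.1 hw).2]
    · rcases (e2 f).1 hf with hf | ⟨b, hb, ⟨-, hbv⟩, rfl⟩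
      exacts [h3' f hf, hstep b hb v (h3 v hv) hbv]
    · by_cases hwv : w = v
      · subst hwv
        exact Or.inr hnew
      rcases (e2 f).1 hf with hf | ⟨b, hb, ⟨hb0, hbv⟩, rfl⟩
      · rcases h4 f hf w hw with h | h
        · exact Or.inl ((e1 w).2 (Or.inl ⟨h, hwv⟩))
        · refine Or.inr fun b hb hb0 hbw => ?_
          obtain ⟨g, hg, hg'⟩ := h b hb hb0 hbw
          exact ⟨g, (e2 g).2 (Or.inl hg), hg'⟩
      · refine Or.inl ((e1 w).2 (Or.inr ⟨b, hb, ⟨hb0, hbv⟩, mem_support_tail.2 ⟨?_, hw⟩⟩))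
        rwa [lt_shift_ppDiv hb0 hbv]
  · by_cases h0 : keysToList (pairsToList sps) = []
    · exact ⟨0, not_not.2 h0⟩
    have hbox : ∀ w ∈ keysToList (pairsToList sps), w ∈ termBox d m C := by
      intro w hw
      obtain ⟨f, hf, hw⟩ := mem_keysToList.1 hw
      exact hpairs f hf hw
    obtain ⟨v, hv, hmax, -⟩ := symPreprocStep_eq (bs := bs)
      (s := (keysToList (pairsToList sps), pairsToList sps)) h0
    obtain ⟨n, hn⟩ := hterm v (hbox v hv).1 (keysToList (pairsToList sps), pairsToList sps)
      hbox hmax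
    exact ⟨n, not_not.2 hn⟩
  · rintro r ⟨hr, ⟨h1, h2, h3, h4⟩, hr'⟩
    refine ⟨r.2, by rw [symPreproc, hr]; rfl, h1, h2, h3.2, ?_⟩
    rw [not_not] at hr'
    intro f hf w hw
    exact (h4 f hf w hw).resolve_left (by simp [hr'])

end SymPreproc

/-! ## Pairs -/

theorem mem_of_mem_distinctPairs {β : Type*} {l : List β} {x : β × β} (h : x ∈ distinctPairs l) :
    x.1 ∈ l ∧ x.2 ∈ l := by
  induction l with
  | nil => simp [distinctPairs] at h
  | cons a l ih =>
    rw [distinctPairs, List.mem_append, List.mem_map] at h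
    rcases h with ⟨b, hb, rfl⟩ | h
    · exact ⟨List.mem_cons_self, List.mem_cons_of_mem _ hb⟩
    · exact ⟨List.mem_cons_of_mem _ (ih h).1, List.mem_cons_of_mem _ (ih h).2⟩

theorem mem_distinctPairs_or {β : Type*} {l : List β} {p q : β} (hp : p ∈ l) (hq : q ∈ l)
    (hpq : p ≠ q) : (p, q) ∈ distinctPairs l ∨ (q, p) ∈ distinctPairs l := by
  induction l with
  | nil => simp at hp
  | cons a l ih =>
    simp only [distinctPairs, List.mem_append, List.mem_map]
    rcases List.mem_cons.1 hp with rfl | hp' <;> rcases List.mem_cons.1 hq with rfl | hq'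
    · exact absurd rfl hpq
    · exact Or.inl (Or.inl ⟨q, hq', rfl⟩)
    · exact Or.inr (Or.inl ⟨p, hp', rfl⟩)
    · exact (ih hp' hq').imp Or.inr Or.inr

theorem mem_addPairs {β : Type*} [DecidableEq β] {bs hs : List β} {ps : List (β × β)} {x : β × β} :
    x ∈ addPairs bs ps hs ↔
      x ∈ ps ∨ (x.1 ∈ hs ∧ x.2 ∈ bs) ∨ x ∈ distinctPairs hs.dedup := by
  have : (∃ a ∈ hs, ∃ b ∈ bs, (a, b) = x) ↔ x.1 ∈ hs ∧ x.2 ∈ bs :=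
    ⟨by rintro ⟨a, ha, b, hb, rfl⟩; exact ⟨ha, hb⟩, fun h => ⟨_, h.1, _, h.2, rfl⟩⟩
  simp only [addPairs, List.mem_append, List.mem_flatMap, List.mem_map, this, or_assoc]
  -- The two sides differ only in the `DecidableEq` instance used by `dedup`.
  convert Iff.rfl

theorem addPairs_nil {β : Type*} (bs : List β) (ps : List (β × β)) : addPairs bs ps [] = ps := by
  simp [addPairs, distinctPairs]

theorem mem_diffList {β : Type*} {xs ys : List β} {x : β} :
    x ∈ diffList xs ys ↔ x ∈ xs ∧ x ∉ ys := by
  simp [diffList]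

theorem length_diffList_lt {β : Type*} {xs ys : List β} (h : ys ≠ []) (hsub : ys ⊆ xs) :
    (diffList xs ys).length < xs.length := by
  obtain ⟨y, hy⟩ := List.exists_mem_of_ne_nil ys h
  rw [diffList, List.length_filter_lt_length_iff_exists]
  exact ⟨y, hsub hy, by simpa using hy⟩

/-! ### Termination and correctness of the algorithm schema -/

section Correctness

variable {α κ K : Type*} [CancelCommMonoid α] [Field K] [Nonempty κ] [LinearOrder (Term α κ)]

theorem multSpan_append_eq {bs hs : List (VPoly α κ K)}
    (h : ∀ f ∈ hs, f ∈ multSpan {b | b ∈ bs} univ) :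
    multSpan {b | b ∈ bs ++ hs} univ = multSpan {b | b ∈ bs} univ := by
  refine le_antisymm (Submodule.span_le.2 ?_)
    (multSpan_mono (fun b hb => List.mem_append_left _ hb) subset_rfl)
  rintro _ ⟨f, hf, hf0, t, -, rfl⟩
  rcases List.mem_append.1 hf with hf | hf
  · exact shift_mem_multSpan hf hf0 (mem_univ _)
  · exact shift_multSpan (fun _ _ => mem_univ _) (h f hf)

variable [LinearOrder α] [LinearOrder κ] [IsTermOrder α κ] [GradedDicksonPowerprod α]

/-- An iteration of the algorithm schema. -/
noncomputable def gbStep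
    (sel : List (VPoly α κ K) → List (VPoly α κ K × VPoly α κ K) →
      List (VPoly α κ K × VPoly α κ K))
    (compl : List (VPoly α κ K) → List (VPoly α κ K × VPoly α κ K) →
      List (VPoly α κ K × VPoly α κ K) → List (VPoly α κ K))
    (s : List (VPoly α κ K) × List (VPoly α κ K × VPoly α κ K)) :
    List (VPoly α κ K) × List (VPoly α κ K × VPoly α κ K) :=
  (s.1 ++ compl s.1 (diffList s.2 (sel s.1 s.2)) (sel s.1 s.2),
    addPairs s.1 (diffList s.2 (sel s.1 s.2))
      (compl s.1 (diffList s.2 (sel s.1 s.2)) (sel s.1 s.2)))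

omit [CancelCommMonoid α] [Nonempty κ] [LinearOrder α] [LinearOrder κ] [IsTermOrder α κ]
  [GradedDicksonPowerprod α] in
theorem mem_of_mem_gbStep {sel : List (VPoly α κ K) → List (VPoly α κ K × VPoly α κ K) →
      List (VPoly α κ K × VPoly α κ K)}
    {compl : List (VPoly α κ K) → List (VPoly α κ K × VPoly α κ K) →
      List (VPoly α κ K × VPoly α κ K) → List (VPoly α κ K)}
    {s : List (VPoly α κ K) × List (VPoly α κ K × VPoly α κ K)}
    (hs : ∀ x ∈ s.2, x.1 ∈ s.1 ∧ x.2 ∈ s.1) :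
    ∀ x ∈ (gbStep sel compl s).2, x.1 ∈ (gbStep sel compl s).1 ∧ x.2 ∈ (gbStep sel compl s).1 := by
  classical
  intro x hx
  simp only [gbStep, List.mem_append]
  rcases mem_addPairs.1 hx with hx | ⟨h1, h2⟩ | hx
  · have := hs x (mem_diffList.1 hx).1
    exact ⟨Or.inl this.1, Or.inl this.2⟩
  · exact ⟨Or.inr h1, Or.inl h2⟩
  · have := mem_of_mem_distinctPairs hx
    exact ⟨Or.inr (List.mem_dedup.1 this.1), Or.inr (List.mem_dedup.1 this.2)⟩

omit [LinearOrder α] [LinearOrder κ] [IsTermOrder α κ] [GradedDicksonPowerprod α] in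
/-- The loop of the algorithm schema terminates if the new polynomials have new leading terms of
bounded degree. -/
theorem exists_gbStep_iterate {d : α → ℕ} (hd : IsDicksonGrading d) {m : ℕ} {C : Set κ}
    (hC : C.Finite)
    {sel : List (VPoly α κ K) → List (VPoly α κ K × VPoly α κ K) →
      List (VPoly α κ K × VPoly α κ K)}
    {compl : List (VPoly α κ K) → List (VPoly α κ K × VPoly α κ K) →
      List (VPoly α κ K × VPoly α κ K) → List (VPoly α κ K)}
    (hsel : ∀ bs ps, ps ≠ [] → sel bs ps ≠ [] ∧ sel bs ps ⊆ ps)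
    (hnew : ∀ bs ps sps, ∀ h ∈ compl bs ps sps, h ≠ 0 ∧ ∀ b ∈ bs, b ≠ 0 → ¬ (lt b).Dvd (lt h))
    (hbox : ∀ bs ps sps, (∀ x ∈ sps, x.1 ∈ bs ∧ x.2 ∈ bs) →
      (∀ b ∈ bs, (b.support : Set _) ⊆ termBox d m C) →
      ∀ h ∈ compl bs ps sps, (h.support : Set _) ⊆ termBox d m C)
    {s : List (VPoly α κ K) × List (VPoly α κ K × VPoly α κ K)}
    (hs : ∀ x ∈ s.2, x.1 ∈ s.1 ∧ x.2 ∈ s.1)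
    (hsbox : ∀ b ∈ s.1, (b.support : Set _) ⊆ termBox d m C) :
    ∃ n : ℕ, ((gbStep sel compl)^[n] s).2 = [] := by
  -- The other stopping test is ignored here: it can only end the loop earlier.
  by_contra! hcon
  set a : ℕ → List (VPoly α κ K) × List (VPoly α κ K × VPoly α κ K) :=
    fun n => (gbStep sel compl)^[n] s with ha
  have hsucc : ∀ n, a (n + 1) = gbStep sel compl (a n) := fun n =>
    Function.iterate_succ_apply' _ _ _
  let hs' : ℕ → List (VPoly α κ K) := fun n =>
    compl (a n).1 (diffList (a n).2 (sel (a n).1 (a n).2)) (sel (a n).1 (a n).2)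
  have hbs : ∀ n, (a (n + 1)).1 = (a n).1 ++ hs' n := fun n => by rw [hsucc]; rfl
  have hinv : ∀ n, (∀ x ∈ (a n).2, x.1 ∈ (a n).1 ∧ x.2 ∈ (a n).1) ∧
      ∀ b ∈ (a n).1, (b.support : Set _) ⊆ termBox d m C := by
    intro n
    induction n with
    | zero => exact ⟨hs, hsbox⟩
    | succ n ih =>
      refine ⟨by rw [hsucc]; exact mem_of_mem_gbStep ih.1, fun b hb => ?_⟩
      rw [hbs] at hb
      rcases List.mem_append.1 hb with hb | hb
      · exact ih.2 b hb
      · exact hbox _ _ _ (fun x hx => ih.1 x ((hsel _ _ (hcon n)).2 hx)) ih.2 b hb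
  have hmono : ∀ i j, i ≤ j → (a i).1 ⊆ (a j).1 := by
    intro i j hij
    induction hij with
    | refl => exact List.Subset.refl _
    | step _ ih =>
      rw [hbs]
      exact List.subset_append_of_subset_left _ ih
  -- If no polynomials were added after step `N`, every later step would strictly shorten the list
  -- of pairs.
  have hfreq : ∀ N, ∃ n > N, hs' n ≠ [] := by
    intro N
    by_contra! hN
    have hlen : ∀ k, (a (N + 1 + k)).2.length + k ≤ (a (N + 1)).2.length := by
      intro k
      induction k with
      | zero => exact le_rfl
      | succ k ih =>
        have h0 : hs' (N + 1 + k) = [] := hN _ (by omega)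
        have h1 : (a (N + 1 + k + 1)).2 =
            diffList (a (N + 1 + k)).2 (sel (a (N + 1 + k)).1 (a (N + 1 + k)).2) := by
          rw [hsucc]
          change addPairs _ _ (hs' (N + 1 + k)) = _
          rw [h0, addPairs_nil]
        have h2 := hsel (a (N + 1 + k)).1 _ (hcon (N + 1 + k))
        have h3 := length_diffList_lt h2.1 h2.2
        rw [← h1] at h3
        change (a (N + 1 + k + 1)).2.length < (a (N + 1 + k)).2.length at h3
        change (a (N + 1 + k + 1)).2.length + (k + 1) ≤ _
        omega
    have := hlen ((a (N + 1)).2.length + 1)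
    omega
  obtain ⟨φ, hφ, hne⟩ := Nat.exists_strictMono_subsequence hfreq
  choose h hh using fun k => List.exists_mem_of_ne_nil _ (hne k)
  have hmem : ∀ k, h k ∈ (a (φ k + 1)).1 := fun k => by
    rw [hbs]; exact List.mem_append_right _ (hh k)
  have hnew' := fun k => hnew _ _ _ (h k) (hh k)
  have hsupp : ∀ k, lt (h k) ∈ termBox d m C := fun k =>
    (hinv _).2 _ (hmem k) (lt_mem_support (hnew' k).1)
  -- Dickson's lemma for one new polynomial from each step that adds some: an earlier leading term
  -- divides a later one, although the earlier polynomial is already in the basis when the later one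
  -- is added.
  obtain ⟨i, j, hij, hdvd⟩ := hd.exists_lt_dvd m hC (fun k => lt (h k))
    (fun k => (hsupp k).1) (fun k => (hsupp k).2)
  exact (hnew' j).2 (h i) (hmono _ _ (hφ hij) (hmem i)) (hnew' i).1 hdvd

variable [WellFoundedLT κ]

/-- The algorithm schema terminates and computes Gröbner bases if every completion step adds
elements of the submodule with new leading terms and resolves the selected pairs. -/
theorem exists_gbSchema_eq_some
    {sel : List (VPoly α κ K) → List (VPoly α κ K × VPoly α κ K) →
      List (VPoly α κ K × VPoly α κ K)}
    {compl : List (VPoly α κ K) → List (VPoly α κ K × VPoly α κ K) →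
      List (VPoly α κ K × VPoly α κ K) → List (VPoly α κ K)}
    (hsel : ∀ bs ps, ps ≠ [] → sel bs ps ≠ [] ∧ sel bs ps ⊆ ps)
    (hnew : ∀ bs ps sps, ∀ h ∈ compl bs ps sps, h ≠ 0 ∧ ∀ b ∈ bs, b ≠ 0 → ¬ (lt b).Dvd (lt h))
    (hbox : ∀ d : α → ℕ, IsDicksonGrading d → ∀ (m : ℕ) (C : Set κ),
      ∀ bs ps sps, (∀ x ∈ sps, x.1 ∈ bs ∧ x.2 ∈ bs) →
      (∀ b ∈ bs, (b.support : Set _) ⊆ termBox d m C) →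
      ∀ h ∈ compl bs ps sps, (h.support : Set _) ⊆ termBox d m C)
    (hpmdl : ∀ bs ps sps, (∀ x ∈ sps, x.1 ∈ bs ∧ x.2 ∈ bs) →
      ∀ h ∈ compl bs ps sps, h ∈ pmdl {b | b ∈ bs})
    (hres : ∀ bs ps sps, (∀ x ∈ sps, x.1 ∈ bs ∧ x.2 ∈ bs) → ∀ p q, (p, q) ∈ sps →
      IsResolved {b | b ∈ bs ++ compl bs ps sps} p q)
    (bs : List (VPoly α κ K)) :
    ∃ gs, gbSchema sel compl bs = some gs ∧ IsGroebnerBasis {g | g ∈ gs} ∧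
      pmdl {g | g ∈ gs} = pmdl {b | b ∈ bs} := by
  classical
  obtain ⟨d, hd⟩ := exists_isDicksonGrading α
  obtain ⟨m, hm⟩ := exists_support_subset_degreeLE d (List.finite_toSet bs)
  -- Only components of the input ever occur, which gives the finite set that Dickson's lemma needs.
  have hC : (⋃ b ∈ {b | b ∈ bs}, Term.comp '' (b.support : Set (Term α κ))).Finite :=
    (List.finite_toSet bs).biUnion fun b _ => b.support.finite_toSet.image _
  have hbsbox : ∀ b ∈ bs, (b.support : Set _) ⊆
      termBox d m (⋃ b ∈ {b | b ∈ bs}, Term.comp '' (b.support : Set (Term α κ))) :=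
    fun b hb v hv => ⟨hm b hb hv, mem_biUnion (show b ∈ {b | b ∈ bs} from hb) ⟨v, hv, rfl⟩⟩
  have hinit : ∀ x ∈ addPairs [] [] bs, x.1 ∈ bs ∧ x.2 ∈ bs := by
    intro x hx
    rcases mem_addPairs.1 hx with hx | ⟨-, hx⟩ | hx
    · simp at hx
    · simp at hx
    · have := mem_of_mem_distinctPairs hx
      exact ⟨List.mem_dedup.1 this.1, List.mem_dedup.1 this.2⟩
  -- Invariant: pairs come from the basis, any two distinct basis elements form a waiting or a
  -- resolved pair, and the submodule is unchanged.
  refine Exists.elim (exists_whileOption_eq_some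
    (c := fun s => ¬ (s.2 = [] ∨ GenWholeModule s.1)) (f := gbStep sel compl)
    (s := (bs, addPairs [] [] bs))
    (fun s => (∀ x ∈ s.2, x.1 ∈ s.1 ∧ x.2 ∈ s.1) ∧
      (∀ p ∈ s.1, ∀ q ∈ s.1, p ≠ q → (p, q) ∈ s.2 ∨ (q, p) ∈ s.2 ∨
        IsResolved {b | b ∈ s.1} p q) ∧
      multSpan {b | b ∈ s.1} univ = multSpan {b | b ∈ bs} univ) ?_ ?_ ?_) ?_
  · refine ⟨hinit, fun p hp q hq hpq => ?_, rfl⟩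
    rcases mem_distinctPairs_or (List.mem_dedup.2 hp) (List.mem_dedup.2 hq) hpq with h | h
    · exact Or.inl (mem_addPairs.2 (Or.inr (Or.inr h)))
    · exact Or.inr (Or.inl (mem_addPairs.2 (Or.inr (Or.inr h))))
  · rintro s ⟨h1, h2, h3⟩ hc
    rw [not_or] at hc
    have hsub := (hsel s.1 s.2 hc.1).2
    have hsps : ∀ x ∈ sel s.1 s.2, x.1 ∈ s.1 ∧ x.2 ∈ s.1 := fun x hx => h1 x (hsub hx)
    have hres' := hres s.1 (diffList s.2 (sel s.1 s.2)) _ hsps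
    have hpm := hpmdl s.1 (diffList s.2 (sel s.1 s.2)) _ hsps
    -- A waiting pair either keeps waiting or was selected and is now resolved.
    have hold : ∀ p q, (p, q) ∈ s.2 → (p, q) ∈ (gbStep sel compl s).2 ∨
        IsResolved {b | b ∈ (gbStep sel compl s).1} p q := by
      intro p q hpq
      by_cases h : (p, q) ∈ sel s.1 s.2
      · exact Or.inr (hres' p q h)
      · exact Or.inl (mem_addPairs.2 (Or.inl (mem_diffList.2 ⟨hpq, h⟩)))
    refine ⟨mem_of_mem_gbStep h1, fun p hp q hq hpq => ?_,
      (multSpan_append_eq fun f hf => mem_pmdl.1 (hpm f hf)).trans h3⟩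
    rcases List.mem_append.1 hp with hp | hp <;> rcases List.mem_append.1 hq with hq | hq
    · rcases h2 p hp q hq hpq with h | h | h
      · exact (hold p q h).imp_right Or.inr
      · exact Or.inr ((hold q p h).imp_right IsResolved.symm)
      · exact Or.inr (Or.inr (h.mono fun b hb => List.mem_append_left _ hb))
    · exact Or.inr (Or.inl (mem_addPairs.2 (Or.inr (Or.inl ⟨hq, hp⟩))))
    · exact Or.inl (mem_addPairs.2 (Or.inr (Or.inl ⟨hp, hq⟩)))
    · rcases mem_distinctPairs_or (List.mem_dedup.2 hp) (List.mem_dedup.2 hq) hpq with h | h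
      · exact Or.inl (mem_addPairs.2 (Or.inr (Or.inr h)))
      · exact Or.inr (Or.inl (mem_addPairs.2 (Or.inr (Or.inr h))))
  · obtain ⟨n, hn⟩ := exists_gbStep_iterate hd hC hsel hnew (hbox d hd m _)
      (s := (bs, addPairs [] [] bs)) hinit hbsbox
    exact ⟨n, not_not.2 (Or.inl hn)⟩
  · rintro s ⟨hs, ⟨-, h2, h3⟩, hc⟩
    refine ⟨s.1, ?_, isGroebnerBasis_of_isReducible (List.finite_toSet s.1) ?_, ?_⟩
    · change (whileOption _ (gbStep sel compl) _).map Prod.fst = _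
      rw [hs]
      rfl
    · intro p hp hp0
      -- If no pairs are left, all are resolved and Buchberger's criterion applies; if the whole
      -- module is generated, reducibility is immediate.
      rcases not_not.1 hc with hnil | hgen
      · refine isReducible_of_isResolved (List.finite_toSet s.1) (fun p hp q hq => ?_) hp hp0
        by_cases hpq : p = q
        · rw [hpq]; exact isResolved_self _ _
        · simpa [hnil] using h2 p hp q hq hpq
      · exact isReducible_of_genWholeModule hgen (mem_pmdl.2 hp) (lt_mem_support hp0)
    · rw [pmdl_eq, pmdl_eq, h3]

/-! ### Properties of one F4 step -/

omit [CancelCommMonoid α] [Nonempty κ] [LinearOrder (Term α κ)] [LinearOrder α] [LinearOrder κ]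
  [IsTermOrder α κ] [GradedDicksonPowerprod α] [WellFoundedLT κ] in
-- A single call of symbolic preprocessing needs only a degree bound, so all components may be
-- allowed; the pairs are bounded separately as they need not come from `bs`.
theorem exists_termBox_univ (d : α → ℕ) (bs : List (VPoly α κ K))
    (sps : List (VPoly α κ K × VPoly α κ K)) :
    ∃ m, (∀ b ∈ bs, (b.support : Set (Term α κ)) ⊆ termBox d m univ) ∧
      ∀ x ∈ sps, (x.1.support : Set (Term α κ)) ⊆ termBox d m univ ∧
        (x.2.support : Set (Term α κ)) ⊆ termBox d m univ := by
  obtain ⟨m, hm⟩ := exists_support_subset_degreeLE (κ := κ) (K := K) d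
    (List.finite_toSet (bs ++ (sps.map Prod.fst ++ sps.map Prod.snd)))
  refine ⟨m, fun b hb v hv => ⟨hm b ?_ hv, mem_univ _⟩,
    fun x hx => ⟨fun v hv => ⟨hm x.1 ?_ hv, mem_univ _⟩, fun v hv => ⟨hm x.2 ?_ hv, mem_univ _⟩⟩⟩
  · exact List.mem_append_left _ hb
  · exact List.mem_append_right _ (List.mem_append_left _ (List.mem_map_of_mem hx))
  · exact List.mem_append_right _ (List.mem_append_right _ (List.mem_map_of_mem hx))

omit [LinearOrder α] [LinearOrder κ] [IsTermOrder α κ] [WellFoundedLT κ] in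
theorem f4Red_eq_of_symPreproc_eq_some {bs fs : List (VPoly α κ K)}
    {sps : List (VPoly α κ K × VPoly α κ K)} (h : symPreproc bs sps = some fs) :
    f4Red bs sps = macaulayRed fs := by
  rw [f4Red, h]
  rfl

/-- The leading term of `h` occurs in `fs`. If some `lt b` divided it, symbolic preprocessing would
have put a polynomial with that leading term into `fs`, and `macaulayRed` would have dropped `h`. -/
theorem f4Red_ne_zero_and_not_dvd {bs : List (VPoly α κ K)}
    {sps : List (VPoly α κ K × VPoly α κ K)} {h : VPoly α κ K} (hh : h ∈ f4Red bs sps) :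
    h ≠ 0 ∧ ∀ b ∈ bs, b ≠ 0 → ¬ (lt b).Dvd (lt h) := by
  obtain ⟨d, hd⟩ := exists_isDicksonGrading α
  obtain ⟨m, hbs, hsps⟩ := exists_termBox_univ d bs sps
  obtain ⟨fs, hfs, -, -, -, hlead⟩ := exists_symPreproc_eq_some hd hbs hsps
  rw [f4Red_eq_of_symPreproc_eq_some hfs] at hh
  obtain ⟨-, h0, hne⟩ := mem_macaulayRed.1 hh
  refine ⟨h0, fun b hb hb0 hdvd => ?_⟩
  have hsupp := support_subset_of_mem_span (S := {v | ∃ f ∈ fs, v ∈ f.support})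
    (fun f hf v hv => ⟨f, hf, hv⟩) (macaulayRed_mem_span hh)
  obtain ⟨f, hf, hv⟩ := hsupp (lt_mem_support h0)
  obtain ⟨g, hg, hg0, hgh⟩ := hlead f hf _ hv b hb hb0 hdvd
  exact hne g hg hg0 hgh

/-- The box does not grow, so the bounds found for the input serve the entire run. -/
theorem f4Red_support_subset {d : α → ℕ} (hd : IsDicksonGrading d) {m : ℕ} {C : Set κ}
    {bs : List (VPoly α κ K)} {sps : List (VPoly α κ K × VPoly α κ K)}
    (hbs : ∀ b ∈ bs, (b.support : Set _) ⊆ termBox d m C)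
    (hsps : ∀ x ∈ sps, x.1 ∈ bs ∧ x.2 ∈ bs)
    {h : VPoly α κ K} (hh : h ∈ f4Red bs sps) : (h.support : Set _) ⊆ termBox d m C := by
  obtain ⟨fs, hfs, -, -, hbox, -⟩ := exists_symPreproc_eq_some hd hbs
    fun x hx => ⟨hbs _ (hsps x hx).1, hbs _ (hsps x hx).2⟩
  rw [f4Red_eq_of_symPreproc_eq_some hfs] at hh
  exact support_subset_of_mem_span hbox (macaulayRed_mem_span hh)

/-- For pairs from `bs`, the initial polynomials are multiples of basis elements too, with scalar `1
/ lc`. -/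
theorem exists_macaulayRed_eq_f4Red {bs : List (VPoly α κ K)}
    {sps : List (VPoly α κ K × VPoly α κ K)} (hsps : ∀ x ∈ sps, x.1 ∈ bs ∧ x.2 ∈ bs) :
    ∃ fs, f4Red bs sps = macaulayRed fs ∧ (∀ f ∈ pairsToList sps, f ∈ fs) ∧
      ∀ f ∈ fs, ∃ b ∈ bs, ∃ (c : K) (t : α), f = c • shift t b := by
  obtain ⟨d, hd⟩ := exists_isDicksonGrading α
  obtain ⟨m, hbs, hsps'⟩ := exists_termBox_univ d bs sps
  obtain ⟨fs, hfs, hpairs, hmult, -, -⟩ := exists_symPreproc_eq_some hd hbs hsps'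
  refine ⟨fs, f4Red_eq_of_symPreproc_eq_some hfs, hpairs, fun f hf => ?_⟩
  rcases hmult f hf with hf | ⟨b, hb, t, rfl⟩
  · rw [pairsToList, List.mem_flatMap] at hf
    obtain ⟨x, hx, hf⟩ := hf
    simp only [List.mem_cons, List.not_mem_nil, or_false, monomMult_eq] at hf
    rcases hf with rfl | rfl
    · exact ⟨_, (hsps x hx).1, _, _, rfl⟩
    · exact ⟨_, (hsps x hx).2, _, _, rfl⟩
  · exact ⟨b, hb, 1, t, (one_smul _ _).symm⟩

theorem f4Red_mem_pmdl {bs : List (VPoly α κ K)} {sps : List (VPoly α κ K × VPoly α κ K)}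
    (hsps : ∀ x ∈ sps, x.1 ∈ bs ∧ x.2 ∈ bs) {h : VPoly α κ K} (hh : h ∈ f4Red bs sps) :
    h ∈ pmdl {b | b ∈ bs} := by
  obtain ⟨fs, hfs, -, hmult⟩ := exists_macaulayRed_eq_f4Red hsps
  rw [hfs] at hh
  rw [mem_pmdl]
  refine Submodule.span_le.2 (fun f hf => ?_) (macaulayRed_mem_span hh)
  obtain ⟨b, hb, c, t, rfl⟩ := hmult f hf
  refine mem_pmdl.1 ?_
  exact pmdl.monomMult c t b (pmdl.base b hb)

/-- The S-polynomial is zero or the difference of two members of `fs`, hence in their span. -/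
theorem redStar_spoly_zero {bs : List (VPoly α κ K)} {sps : List (VPoly α κ K × VPoly α κ K)}
    (hsps : ∀ x ∈ sps, x.1 ∈ bs ∧ x.2 ∈ bs) {p q : VPoly α κ K} (hpq : (p, q) ∈ sps) :
    RedStar {b | b ∈ bs ++ f4Red bs sps} (spoly p q) 0 := by
  obtain ⟨fs, hfs, hpairs, hmult⟩ := exists_macaulayRed_eq_f4Red hsps
  rw [hfs]
  refine redStar_zero_of_mem_span hmult ?_
  rw [spoly]
  split_ifs
  · refine sub_mem (Submodule.subset_span (hpairs _ ?_)) (Submodule.subset_span (hpairs _ ?_)) <;>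
      exact List.mem_flatMap.2 ⟨_, hpq, by simp⟩
  · exact zero_mem _

end Correctness

end F4

/-! ### The main theorem -/

open F4
theorem mainTheorem3 {α κ K : Type*} [CancelCommMonoid α] [GradedDicksonPowerprod α]
    [LinearOrder κ] [WellFoundedLT κ] [Nonempty κ] [Field K]
    [LinearOrder α] [LinearOrder (Term α κ)] [IsTermOrder α κ] :
    -- symbolic preprocessing terminates
    (∀ (bs : List (VPoly α κ K)) (sps : List (VPoly α κ K × VPoly α κ K)),
      ∃ fs, symPreproc bs sps = some fs ∧ f4Red bs sps = macaulayRed fs) ∧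
    -- the new polynomials are non-zero with leading terms not divisible by old leading terms
    (∀ (bs : List (VPoly α κ K)) (sps : List (VPoly α κ K × VPoly α κ K)),
      ∀ h ∈ f4Red bs sps, h ≠ 0 ∧ ∀ b ∈ bs, b ≠ 0 → ¬ (lt b).Dvd (lt h)) ∧
    -- they lie in the submodule generated by the basis, and all selected S-polynomials reduce to 0
    (∀ (bs : List (VPoly α κ K)) (sps : List (VPoly α κ K × VPoly α κ K)),
      (∀ x ∈ sps, x.1 ∈ bs ∧ x.2 ∈ bs) →
        (∀ h ∈ f4Red bs sps, h ∈ pmdl {b | b ∈ bs}) ∧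
        ∀ p q, (p, q) ∈ sps → RedStar {b | b ∈ bs ++ f4Red bs sps} (spoly p q) 0) ∧
    -- F4 terminates and computes a Gröbner basis of the submodule generated by its input
    (∀ (sel : List (VPoly α κ K) → List (VPoly α κ K × VPoly α κ K) →
          List (VPoly α κ K × VPoly α κ K))
        (keep : List (VPoly α κ K) → List (VPoly α κ K × VPoly α κ K) →
          List (VPoly α κ K × VPoly α κ K) → List (VPoly α κ K × VPoly α κ K)),
      (∀ bs ps, ps ≠ [] → sel bs ps ≠ [] ∧ sel bs ps ⊆ ps) →
      (∀ bs ps sps, keep bs ps sps ⊆ sps ∧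
        ∀ p q, (p, q) ∈ sps → (p, q) ∉ keep bs ps sps → IsDiscardable bs p q) →
      ∀ bs : List (VPoly α κ K), ∃ gs : List (VPoly α κ K), f4 sel keep bs = some gs ∧
        IsGroebnerBasis {g | g ∈ gs} ∧ pmdl {g | g ∈ gs} = pmdl {b | b ∈ bs}) := by
  refine ⟨fun bs sps => ?_, fun bs sps h hh => f4Red_ne_zero_and_not_dvd hh,
    fun bs sps hsps => ⟨fun h hh => f4Red_mem_pmdl hsps hh,
      fun p q hpq => redStar_spoly_zero hsps hpq⟩, fun sel keep hsel hkeep bs => ?_⟩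
  · obtain ⟨d, hd⟩ := exists_isDicksonGrading α
    obtain ⟨m, hbs, hsps⟩ := exists_termBox_univ d bs sps
    obtain ⟨fs, hfs, -⟩ := exists_symPreproc_eq_some hd hbs hsps
    exact ⟨fs, hfs, f4Red_eq_of_symPreproc_eq_some hfs⟩
  · have hsub : ∀ bs ps sps, (∀ x ∈ sps, x.1 ∈ bs ∧ x.2 ∈ bs) →
        ∀ x ∈ keep bs ps sps, x.1 ∈ bs ∧ x.2 ∈ bs :=
      fun bs ps sps h x hx => h x ((hkeep bs ps sps).1 hx)
    refine exists_gbSchema_eq_some hsel (fun bs ps sps h hh => f4Red_ne_zero_and_not_dvd hh)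
      (fun d hd m C bs ps sps hsps hbox h hh =>
        f4Red_support_subset hd hbox (hsub bs ps sps hsps) hh)
      (fun bs ps sps hsps h hh => f4Red_mem_pmdl (hsub bs ps sps hsps) hh) ?_ bs
    intro bs ps sps hsps p q hpq
    -- Kept pairs reduce to `0` modulo the enlarged basis; discarded ones are already resolved
    -- modulo the old basis.
    by_cases hk : (p, q) ∈ keep bs ps sps
    · exact isResolved_of_redStar (redStar_spoly_zero (hsub bs ps sps hsps) hk)
    · exact (((hkeep bs ps sps).2 p q hpq hk).isResolved (hsps _ hpq).1 (hsps _ hpq).2).mono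
        fun b hb => List.mem_append_left _ hb
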